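/- There are absolute constants $c, K > 0$ such that for every integer $N \ge 1$ there is a random setting of one-dimensional online prediction as follows. The domain is $\mathcal{X} = \mathbb{N}$ and the example of round $t$ is $x_t = t$. There are a number $m \ge 1$ and, on a common probability space, a random finite class $\mathcal{F} = \{f_1, \dots, f_m\}$ of functions $\mathbb{N} \to \mathbb{R}$ and a random sequence of labels $y^\star_t \in [0,1]$, such that: 1. $\mathcal{F}$ is always $1$-bounded ($|f(x)| \le 1$ for all $f\in\mathcal F$ and $x$), closed under negation, and contains the zero function. 2. The base learner $\mathcal{A}$ is Hedge over $f_1, \dots, f_m$: it predicts $f_J(x)$, where $J$ is drawn with fresh randomness at each call, $\Pr[J=j]$ being proportional to $\exp(-\eta_t L_j)$, where $L_j$ is the total loss of $f_j$ on the $t-1$ (example, loss) pairs received so far and $\eta_t = \sqrt{(\log m)/t}$. It is an online linear learning algorithm for $\mathcal{F}$: against every adaptive adversary choosing an example and a linear loss $y \mapsto g y$ with $|g| \le 1$ in each round, for every $T$ and every $\delta \in (0,1)$, with probability at least $1-\delta$ its regret against $\mathcal{F}$ after $T$ rounds is at most $K(\sqrt{T \log m} + \sqrt{T \log(1/\delta)})$.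 3. The losses are $\ell_t(y) = \frac12 (y - y^\star_t)^2$. They lie in the class $\mathcal{C}$ of all $\ell(y) = \frac12 (y-y^\star)^2$ with $y^\star \in [0,1]$, which are convex and $1$-smooth on $\mathbb{R}$, i.e. $\ell(y') \le \ell(y) + \ell'(y)(y'-y) + \frac12|y-y'|^2$ for all $y,y'$. An online boosting algorithm with budget $N$ accesses $\mathcal{F}$ only through copies of $\mathcal{A}$, and may use private randomness. In each round $t$ it sees $x_t$, makes (adaptively) at most $N$ calls in total to copies of $\mathcal{A}$ on the example $x_t$, outputs a prediction $y_t \in \mathbb{R}$, sees $\ell_t$, and may then pass to each copy a linear loss with slope in $[-1,1]$ for the example $x_t$. Then for every such online boosting algorithm (which may depend on the law of the setting, but not on the drawn class and labels) and every $T \ge 0$, with probability at least $\frac{1}{10}$ over the draw of the setting, the randomness of the copies of $\mathcal{A}$ and that of the algorithm, \[ \sum_{t=0}^{T-1} \ell_t(y_t) - \inf_{f \in \mathrm{CH}(\mathcal{F})} \sum_{t=0}^{T-1} \ell_t(f(x_t)) \ \ge\ \frac{c\,T}{N}, \] where $\mathrm{CH}(\mathcal{F})$ is the convex hull of $\mathcal{F}$.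 -/

import Mathlib

open MeasureTheory

noncomputable section

namespace OnlineBoosting

/-- One round of online prediction: the example, the loss function, and the prediction made. -/
structure Play (X : Type*) where
  /-- the example shown in the round -/
  example_ : X
  /-- the loss function of the round -/
  loss : ℝ → ℝ
  /-- the prediction of the learner, made before it sees the loss -/
  prediction : ℝ

/-- Regret of a sequence of plays against a class `K` of comparator functions: the total loss of the
predictions minus the infimum over `K` of the total loss of a fixed comparator. -/
def regret {X : Type*} (K : Set (X → ℝ)) (h : List (Play X)) : ℝ :=
  (h.map fun r => r.loss r.prediction).sum
    - ⨅ k : K, (h.map fun r => r.loss (k.1 r.example_)).sum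

/-- A randomized online learner with one-dimensional predictions. Given the examples and losses it
has received so far (most recent first) and the current example, it returns the law of its
prediction; the randomness is fresh at every call. -/
abbrev OnlineLearner (X : Type*) := List (X × (ℝ → ℝ)) → X → PMF ℝ

/-- The law of the first `T` plays of the learner `A` (most recent first) against an adaptive
adversary `adv`, which picks the example and a loss in `C` from the past plays. -/
def learnerRun {X : Type*} (A : OnlineLearner X) {C : Set (ℝ → ℝ)}
    (adv : List (Play X) → X × C) : ℕ → PMF (List (Play X))
  | 0 => PMF.pure []
  | T + 1 => (learnerRun A adv T).bind fun h =>
      (A (h.map fun r => (r.example_, r.loss)) (adv h).1).map fun v =>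
        ⟨(adv h).1, (adv h).2.1, v⟩ :: h

/-- `A` is an online learning algorithm for the class `F` and losses in `C` with regret bound
`R T δ` after `T` rounds, valid with probability at least `1 - δ`, against every adversary. -/
def IsOnlineLearner {X : Type*} (A : OnlineLearner X) (F : Set (X → ℝ)) (C : Set (ℝ → ℝ))
    (R : ℕ → ℝ → ℝ) : Prop :=
  ∀ (adv : List (Play X) → X × C) (T : ℕ) (δ : ℝ), 0 < δ → δ < 1 →
    ENNReal.ofReal (1 - δ) ≤ (learnerRun A adv T).toOuterMeasure {h | regret F h ≤ R T δ}

/-- The linear functions on the line with Lipschitz constant at most `1`. -/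
def linearLosses : Set (ℝ → ℝ) := {ℓ | ∃ g : ℝ, |g| ≤ 1 ∧ ℓ = fun y => g * y}

/-- The squared loss with label `a`. -/
def sqLoss (a : ℝ) : ℝ → ℝ := fun y => (y - a) ^ 2 / 2

/-- The squared losses with labels in `[0, 1]`. -/
def squaredLosses : Set (ℝ → ℝ) := {ℓ | ∃ a ∈ Set.Icc (0 : ℝ) 1, ℓ = sqLoss a}

/-- A class of (differentiable) convex losses that is `β`-smooth on the line. -/
def IsConvexSmooth (β : ℝ) (C : Set (ℝ → ℝ)) : Prop :=
  ∀ ℓ ∈ C, ConvexOn ℝ Set.univ ℓ ∧ Differentiable ℝ ℓ ∧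
    ∀ y y' : ℝ, ℓ y' ≤ ℓ y + deriv ℓ y * (y' - y) + β / 2 * |y - y'| ^ 2

/-- `F` is `D`-bounded. -/
def IsBoundedClass {X : Type*} (D : ℝ) (F : Set (X → ℝ)) : Prop := ∀ h ∈ F, ∀ x, |h x| ≤ D

/-- `F` is closed under negation and contains the zero function. -/
def IsSymmetricClass {X : Type*} (F : Set (X → ℝ)) : Prop := 0 ∈ F ∧ ∀ h ∈ F, -h ∈ F

/-- The Hedge weight of the `j`-th function after the feedback in `mem`:
`exp (-η * (total loss of f j))`, with `η = √(log m / t)` in the `t`-th round. -/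
def hedgeWeight {X : Type*} {m : ℕ} (f : Fin m → X → ℝ) (mem : List (X × (ℝ → ℝ)))
    (j : Fin m) : ℝ :=
  Real.exp (-(Real.sqrt (Real.log m / (mem.length + 1)) * (mem.map fun r => r.2 (f j r.1)).sum))

/-- The random choice of Hedge: an index drawn with probability proportional to its weight. -/
def hedgeIndex {X : Type*} {m : ℕ} [NeZero m] (f : Fin m → X → ℝ) (mem : List (X × (ℝ → ℝ))) :
    PMF (Fin m) :=
  PMF.normalize (fun j => ENNReal.ofReal (hedgeWeight f mem j))
    (by
      intro h
      have h0 := (ENNReal.tsum_eq_zero.mp h) 0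
      rw [ENNReal.ofReal_eq_zero] at h0
      exact absurd h0 (not_le.mpr (Real.exp_pos _)))
    (by
      rw [tsum_fintype]
      exact ENNReal.sum_ne_top.mpr fun _ _ => ENNReal.ofReal_ne_top)

/-- Hedge over `f 0, …, f (m - 1)`: draw one of the functions and predict with it. -/
def hedge {X : Type*} {m : ℕ} [NeZero m] (f : Fin m → X → ℝ) : OnlineLearner X :=
  fun mem x => (hedgeIndex f mem).map fun j => f j x

/-- A round of a boosting algorithm: the play, and the answers (most recent first) that the calls
to the copies of the base learner returned in this round. -/
structure Round (X : Type*) extends Play X where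
  /-- the predictions returned by the calls of the round -/
  answers : List ℝ

/-- An online boosting algorithm with its random seed fixed. It has access to copies, numbered by
`ℕ`, of a base online linear learner. It does not depend on the comparator class: it learns about it
only from the answers of the copies. Past rounds are listed most recent first. -/
structure Booster (X : Type*) where
  /-- From the past rounds, the current example, and the answers obtained so far in the current
  round: the copy to call next on the current example, or `none` to make no further call. -/
  call : List (Round X) → X → List ℝ → Option ℕ
  /-- From the past rounds, the current example, and the answers of the current round: the
  prediction. -/
  predict : List (Round X) → X → List ℝ → ℝ
  /-- From all rounds up to and including the current one (so after its loss has been seen): the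
  linear loss passed to each copy for the current example, or `none` for no update. -/
  feedback : List (Round X) → ℕ → Option linearLosses

/-- The calling phase of a round: the law of the answers when at most `n` more calls are allowed and
the answers `a` have been obtained already. Here `mem i` is the feedback received by copy `i` in
earlier rounds and `x` is the current example. -/
def answersLaw {X : Type*} (A : OnlineLearner X) (mem : ℕ → List (X × (ℝ → ℝ))) (x : X)
    (ask : List ℝ → Option ℕ) : ℕ → List ℝ → PMF (List ℝ)
  | 0, a => PMF.pure a
  | n + 1, a =>
    match ask a with
    | none => PMF.pure a
    | some i => (A (mem i) x).bind fun v => answersLaw A mem x ask n (v :: a)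

/-- The rounds played so far, and the feedback received so far by each copy of the base learner. -/
structure RunState (X : Type*) where
  /-- past rounds, most recent first -/
  rounds : List (Round X)
  /-- the examples and linear losses passed to each copy, most recent first -/
  memory : ℕ → List (X × (ℝ → ℝ))

/-- The state after a round with example `x`, loss `ℓ` and answers `a`. -/
def nextState {X : Type*} (B : Booster X) (x : X) (ℓ : ℝ → ℝ) (st : RunState X) (a : List ℝ) :
    RunState X :=
  let rounds : List (Round X) := ⟨⟨x, ℓ, B.predict st.rounds x a⟩, a⟩ :: st.rounds
  { rounds := rounds
    memory := fun i =>
      match B.feedback rounds i with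
      | none => st.memory i
      | some g => (x, g.1) :: st.memory i }

/-- The law of the state after `T` rounds of the booster `B` with at most `N` calls per round to the
copies of `A`, on the examples `x 0, x 1, …` and losses `ℓ 0, ℓ 1, …`. -/
def boostRun {X : Type*} (A : OnlineLearner X) (N : ℕ) (B : Booster X) (x : ℕ → X)
    (ℓ : ℕ → ℝ → ℝ) : ℕ → PMF (RunState X)
  | 0 => PMF.pure ⟨[], fun _ => []⟩
  | T + 1 => (boostRun A N B x ℓ T).bind fun st =>
      (answersLaw A st.memory (x T) (B.call st.rounds (x T)) N []).map
        (nextState B (x T) (ℓ T) st)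

/-- The probability that the booster's regret after `T` rounds against the convex hull of `F` is at
least `r`. -/
def probRegretGE {X : Type*} (A : OnlineLearner X) (N : ℕ) (B : Booster X) (F : Set (X → ℝ))
    (x : ℕ → X) (ℓ : ℕ → ℝ → ℝ) (T : ℕ) (r : ℝ) : ENNReal :=
  (boostRun A N B x ℓ T).toOuterMeasure
    {st | r ≤ regret (convexHull ℝ F) (st.rounds.map Round.toPlay)}

end OnlineBoosting

end

/-!
The rounds are independent. In each of them a fair bit selects the label `δ` or `0`, where
`δ ^ 2 = 1 / (100 * N)`, and then `32000 * N` independent signs with mean equal to the label are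
drawn. The class consists of the functions that read off one of these signs, their negatives, and
zero.

A call to Hedge in a round reveals at most one of the signs of that round, because the law of the
drawn index involves only the values of the class in earlier rounds. After `N` calls, adaptively
placed and possibly with repetitions, the likelihood ratio of the two labels has `χ²`-distance at
most `(1 + δ ^ 2) ^ N - 1 ≤ 1 / 99` from `1`, so with probability at least `9 / 20` the prediction
is on the wrong side of `δ / 2` and costs at least `δ ^ 2 / 8 = 1 / (800 * N)`. The bound on the error
probability is an induction on the number of remaining calls with a potential that is quadratic in
the two posteriors (`errorPotential_le`). Since redrawing one round does not change the law of the
setting (`lintegral_infinitePi_resample`), the expected number of such mistakes in `T` rounds is at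
least `9 / 20 * T` (`le_lintegral_mistakes`).

The average of all the sign functions lies in the convex hull and predicts the label up to variance
`4 / (32000 * N)`, so its loss is negligible compared with that of the mistakes. As the number of
mistakes never exceeds `T`, a large expected number of mistakes already forces a regret of order
`T / N` with constant probability, for every `T` and without concentration of measure
(`one_tenth_le_lintegral_probRegretGE`).

That Hedge with rate `√(log m / t)` satisfies the regret bound with high probability
(`isOnlineLearner_hedge`) follows from one exponential supermartingale, which compares the realized
loss with the soft minimum of the cumulative losses. The soft minimum decreases with the inverse
temperature, so a decreasing learning rate only helps.
-/

open MeasureTheory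

namespace OnlineBoosting

/-! ### Random signs with prescribed means -/

/-- The sign `±1` encoded by a bit. -/
def spin (b : Bool) : ℝ := if b then 1 else -1

@[simp] theorem spin_true : spin true = 1 := by simp [spin]

@[simp] theorem spin_false : spin false = -1 := by simp [spin]

theorem abs_spin (b : Bool) : |spin b| = 1 := by cases b <;> simp

/-- The probability of the signs `v` when the sign at each `j` is drawn independently with mean
`p j`. A mean `p j = ±1` means that this sign is fixed. -/
noncomputable def spinWeight {ι : Type*} [Fintype ι] (p : ι → ℝ) (v : ι → Bool) : ℝ :=
  ∏ j, (1 + p j * spin (v j)) / 2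

section SpinWeight

variable {ι : Type*} [Fintype ι]

theorem spinWeight_nonneg {p : ι → ℝ} (hp : ∀ j, |p j| ≤ 1) (v : ι → Bool) :
    0 ≤ spinWeight p v := by
  refine Finset.prod_nonneg fun j _ => ?_
  obtain ⟨h1, h2⟩ := abs_le.mp (hp j)
  cases v j <;> simp <;> linarith

theorem sum_spinWeight [DecidableEq ι] (p : ι → ℝ) : ∑ v, spinWeight p v = 1 := by
  have h := Finset.prod_univ_sum (fun _ : ι => (Finset.univ : Finset Bool))
    (fun j b => (1 + p j * spin b) / 2)
  rw [Fintype.piFinset_univ] at h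
  rw [show ∑ v, spinWeight p v = _ from h.symm]
  refine Finset.prod_eq_one fun j _ => ?_
  rw [Fintype.sum_bool, spin_true, spin_false]
  ring

/-- Conditioning on the sign at `j`. -/
theorem spinWeight_split [DecidableEq ι] (p : ι → ℝ) (j : ι) (v : ι → Bool) :
    spinWeight p v = (1 + p j) / 2 * spinWeight (Function.update p j (spin true)) v
      + (1 - p j) / 2 * spinWeight (Function.update p j (spin false)) v := by
  have key : ∀ s : ℝ, spinWeight (Function.update p j s) v
      = (1 + s * spin (v j)) / 2 * ∏ i ∈ Finset.univ.erase j, (1 + p i * spin (v i)) / 2 := by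
    intro s
    rw [spinWeight, ← Finset.mul_prod_erase _ _ (Finset.mem_univ j)]
    congr 1
    · simp
    · refine Finset.prod_congr rfl fun i hi => ?_
      rw [Function.update_of_ne (Finset.ne_of_mem_erase hi)]
  have h0 := key (p j)
  rw [Function.update_eq_self] at h0
  rw [h0, key, key]
  cases v j <;> simp only [spin_true, spin_false] <;> ring

/-- A sign of mean `±1` is deterministic. -/
theorem spinWeight_mul_of_eq_spin {p : ι → ℝ} {j : ι} {s : Bool} (hp : p j = spin s)
    (v : ι → Bool) (F : Bool → ℝ) : spinWeight p v * F (v j) = spinWeight p v * F s := by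
  by_cases h : v j = s
  · rw [h]
  · have : spinWeight p v = 0 := by
      refine Finset.prod_eq_zero (Finset.mem_univ j) ?_
      rw [hp]
      cases hv : v j <;> cases s <;> simp_all
    rw [this, zero_mul, zero_mul]

theorem sum_spinWeight_split [DecidableEq ι] (p : ι → ℝ) (j : ι) (F : Bool → (ι → Bool) → ℝ) :
    ∑ v, spinWeight p v * F (v j) v
      = (1 + p j) / 2 * ∑ v, spinWeight (Function.update p j (spin true)) v * F true v
        + (1 - p j) / 2 * ∑ v, spinWeight (Function.update p j (spin false)) v * F false v := by
  rw [Finset.mul_sum, Finset.mul_sum, ← Finset.sum_add_distrib]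
  refine Finset.sum_congr rfl fun v _ => ?_
  have h1 := spinWeight_mul_of_eq_spin (p := Function.update p j (spin true)) (j := j)
    (Function.update_self ..) v (fun b => F b v)
  have h2 := spinWeight_mul_of_eq_spin (p := Function.update p j (spin false)) (j := j)
    (Function.update_self ..) v (fun b => F b v)
  rw [← h1, ← h2, spinWeight_split p j v]
  ring

/-- The average of `card ι` independent signs of mean `q` has variance at most `4 / card ι`. -/
theorem sum_spinWeight_mul_sq_le [DecidableEq ι] [Nonempty ι] {q : ℝ} (hq : |q| ≤ 1) :
    ∑ v, spinWeight (fun _ : ι => q) v * ((∑ j, spin (v j)) / Fintype.card ι - q) ^ 2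
      ≤ 4 / Fintype.card ι := by
  set p : ι → ℝ := fun _ => q
  have hM : (0 : ℝ) < Fintype.card ι := by exact_mod_cast Fintype.card_pos
  have hoff : ∀ i k : ι, i ≠ k →
      ∑ v, spinWeight p v * ((spin (v i) - q) * (spin (v k) - q)) = 0 := by
    intro i k hik
    have h := Finset.prod_univ_sum (fun _ : ι => (Finset.univ : Finset Bool))
      (fun j b => (1 + p j * spin b) / 2 * ((if j = i then spin b - q else 1)
        * (if j = k then spin b - q else 1)))
    rw [Fintype.piFinset_univ] at h
    have h2 : ∀ v : ι → Bool, spinWeight p v * ((spin (v i) - q) * (spin (v k) - q))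
        = ∏ j, ((1 + p j * spin (v j)) / 2 * ((if j = i then spin (v j) - q else 1)
        * (if j = k then spin (v j) - q else 1))) := by
      intro v
      rw [Finset.prod_mul_distrib, Finset.prod_mul_distrib, Finset.prod_ite_eq',
        Finset.prod_ite_eq']
      simp [spinWeight]
    rw [Finset.sum_congr rfl fun v _ => h2 v, ← h]
    refine Finset.prod_eq_zero (Finset.mem_univ i) ?_
    simp [hik, p]
    ring
  have hdiag : ∀ i : ι, ∑ v, spinWeight p v * ((spin (v i) - q) * (spin (v i) - q)) ≤ 4 := by
    intro i
    calc ∑ v, spinWeight p v * ((spin (v i) - q) * (spin (v i) - q))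
        ≤ ∑ v, spinWeight p v * 4 := by
          refine Finset.sum_le_sum fun v _ => mul_le_mul_of_nonneg_left ?_
            (spinWeight_nonneg (fun _ => hq) v)
          obtain ⟨h1, h2⟩ := abs_le.mp hq
          cases v i <;> simp <;> nlinarith
      _ = 4 := by rw [← Finset.sum_mul, sum_spinWeight, one_mul]
  have hsq : ∀ v : ι → Bool, ((∑ j, spin (v j)) / Fintype.card ι - q) ^ 2
      = (∑ i, ∑ k, (spin (v i) - q) * (spin (v k) - q)) / (Fintype.card ι : ℝ) ^ 2 := by
    intro v
    rw [← Finset.sum_mul_sum, Finset.sum_sub_distrib, Finset.sum_const, Finset.card_univ,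
      nsmul_eq_mul]
    field_simp
  calc ∑ v, spinWeight p v * ((∑ j, spin (v j)) / Fintype.card ι - q) ^ 2
      = (∑ i, ∑ k, ∑ v, spinWeight p v * ((spin (v i) - q) * (spin (v k) - q)))
          / (Fintype.card ι : ℝ) ^ 2 := by
        rw [Finset.sum_congr rfl fun v _ => by rw [hsq v, ← mul_div_assoc], ← Finset.sum_div]
        congr 1
        simp_rw [Finset.mul_sum]
        rw [Finset.sum_comm]
        refine Finset.sum_congr rfl fun i _ => ?_
        rw [Finset.sum_comm]
    _ ≤ (∑ _i : ι, 4) / (Fintype.card ι : ℝ) ^ 2 := by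
        gcongr with i
        rw [Finset.sum_eq_single i (fun k _ hk => hoff i k hk.symm) (by simp)]
        exact hdiag i
    _ = 4 / Fintype.card ι := by
        rw [Finset.sum_const, Finset.card_univ, nsmul_eq_mul]
        field_simp

end SpinWeight

/-! ### Two labels that few calls cannot tell apart -/

theorem toReal_toOuterMeasure_bind {κ β : Type*} [Fintype κ] (p : PMF κ) (g : κ → PMF β)
    (G : Set β) :
    ((p.bind g).toOuterMeasure G).toReal
      = ∑ k, (p k).toReal * ((g k).toOuterMeasure G).toReal := by
  have hfin : ∀ k, (g k).toOuterMeasure G ≠ ⊤ := fun k =>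
    ne_top_of_le_ne_top ENNReal.one_ne_top
      (((g k).toOuterMeasure.mono (Set.subset_univ G)).trans
        ((PMF.toOuterMeasure_apply_eq_one_iff _ _).mpr (Set.subset_univ _)).le)
  rw [PMF.toOuterMeasure_bind_apply, tsum_fintype, ENNReal.toReal_sum fun k _ =>
    ENNReal.mul_ne_top (p.apply_ne_top k) (hfin k)]
  simp_rw [ENNReal.toReal_mul]

theorem sum_toReal_pmf {κ : Type*} [Fintype κ] (p : PMF κ) : ∑ k, (p k).toReal = 1 := by
  have h := p.tsum_coe
  rw [tsum_fintype] at h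
  rw [← ENNReal.toReal_sum fun k _ => p.apply_ne_top k, h, ENNReal.toReal_one]

/-- A lower bound for the sum of the two error probabilities when `n` more signs may be revealed and
the hypotheses "mean `δ`" and "mean `0`" have the unnormalized posteriors `α` and `β`. It comes from
`min α β = (α + β) / 2 - |α - β| / 2` and `|d| / 2 ≤ τ / 4 + d ^ 2 / (4 * τ)` with `τ = 1 / 10`; the
expectation of `(α - β) ^ 2` after `n` reveals is `(α - β) ^ 2 + ((1 + δ ^ 2) ^ n - 1) * α ^ 2`. -/
noncomputable def errorPotential (δ : ℝ) (n : ℕ) (α β : ℝ) : ℝ :=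
  (α + β) / 2 - 1 / 40 - 5 / 2 * ((α - β) ^ 2 + ((1 + δ ^ 2) ^ n - 1) * α ^ 2)

theorem errorPotential_succ_le (δ : ℝ) (n : ℕ) (α β : ℝ) :
    errorPotential δ (n + 1) α β ≤ errorPotential δ n α β := by
  have h : (1 + δ ^ 2) ^ n ≤ (1 + δ ^ 2) ^ (n + 1) :=
    pow_le_pow_right₀ (by nlinarith [sq_nonneg δ]) n.le_succ
  have := mul_le_mul_of_nonneg_right h (sq_nonneg α)
  unfold errorPotential
  linarith

theorem errorPotential_succ_eq (δ : ℝ) (n : ℕ) (α β : ℝ) :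
    errorPotential δ (n + 1) α β = (errorPotential δ n (α * (1 + δ)) β
      + errorPotential δ n (α * (1 - δ)) β) / 2 := by
  unfold errorPotential
  rw [pow_succ]
  ring

theorem errorPotential_le_min (δ : ℝ) (n : ℕ) (α β : ℝ) :
    errorPotential δ n α β ≤ min α β := by
  have h : 1 ≤ (1 + δ ^ 2) ^ n := one_le_pow₀ (by nlinarith [sq_nonneg δ])
  have h2 : 0 ≤ ((1 + δ ^ 2) ^ n - 1) * α ^ 2 := mul_nonneg (by linarith) (sq_nonneg α)
  unfold errorPotential
  rw [le_min_iff]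
  constructor
  · nlinarith [sq_nonneg (α - β + 1 / 10)]
  · nlinarith [sq_nonneg (α - β - 1 / 10)]

/-- The potential is a lower bound for the error probabilities of the test that accepts label `δ`
off `G` and label `0` on `G`, after at most `n` further calls to learners that pick an index by a law
`w i` which does not involve the current signs. The means `p`, `q` under the two hypotheses agree at
the signs already revealed. -/
theorem errorPotential_le {X ι κ : Type*} [Fintype ι] [DecidableEq ι] [Fintype κ] {δ : ℝ}
    (hδ0 : 0 ≤ δ) (hδ1 : δ ≤ 1) {A : (ι → Bool) → OnlineLearner X}
    {mem : ℕ → List (X × (ℝ → ℝ))} {x : X} {w : ℕ → PMF κ} {c : κ → ℝ} {b : κ → ι}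
    (hA : ∀ i v, A v (mem i) x = (w i).map fun k => c k * spin (v (b k)))
    (ask : List ℝ → Option ℕ) (G : Set (List ℝ)) (n : ℕ) :
    ∀ (a : List ℝ) (p q : ι → ℝ) (α β : ℝ), 0 ≤ α → 0 ≤ β →
      (∀ j, (p j = δ ∧ q j = 0) ∨ (p j = q j ∧ ∃ s, p j = spin s)) →
      errorPotential δ n α β
        ≤ α * ∑ v, spinWeight p v *
            ((answersLaw (A v) mem x ask n a).toOuterMeasure G).toReal
          + β * ∑ v, spinWeight q v *
            ((answersLaw (A v) mem x ask n a).toOuterMeasure Gᶜ).toReal := by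
  classical
  have hpure : ∀ (n : ℕ) (a : List ℝ) (p q : ι → ℝ) (α β : ℝ), errorPotential δ n α β
      ≤ α * ∑ v, spinWeight p v * ((PMF.pure a).toOuterMeasure G).toReal
          + β * ∑ v, spinWeight q v * ((PMF.pure a).toOuterMeasure Gᶜ).toReal := by
    intro n a p q α β
    rw [← Finset.sum_mul, ← Finset.sum_mul, sum_spinWeight, sum_spinWeight,
      PMF.toOuterMeasure_pure_apply, PMF.toOuterMeasure_pure_apply]
    have h := le_min_iff.mp (errorPotential_le_min δ n α β)
    by_cases ha : a ∈ G
    · simpa [ha] using h.1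
    · simpa [ha] using h.2
  induction n with
  | zero => exact fun a p q α β _ _ _ => hpure 0 a p q α β
  | succ n ih =>
    intro a p q α β hα hβ hpq
    rcases hask : ask a with _ | i
    · simp only [answersLaw, hask]
      exact hpure (n + 1) a p q α β
    · set hit : Set (List ℝ) → (ι → Bool) → List ℝ → ℝ := fun G v a =>
        ((answersLaw (A v) mem x ask n a).toOuterMeasure G).toReal with hhit
      have hstep : ∀ (G : Set (List ℝ)) (v : ι → Bool),
          ((answersLaw (A v) mem x ask (n + 1) a).toOuterMeasure G).toReal
            = ∑ k, (w i k).toReal * hit G v (c k * spin (v (b k)) :: a) := by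
        intro G v
        simp only [answersLaw, hask]
        rw [hA, PMF.bind_map, toReal_toOuterMeasure_bind]
        rfl
      have hswap : ∀ (G : Set (List ℝ)) (p : ι → ℝ),
          ∑ v, spinWeight p v * ∑ k, (w i k).toReal * hit G v (c k * spin (v (b k)) :: a)
            = ∑ k, (w i k).toReal *
              ∑ v, spinWeight p v * hit G v (c k * spin (v (b k)) :: a) := by
        intro G p
        simp_rw [Finset.mul_sum]
        rw [Finset.sum_comm]
        refine Finset.sum_congr rfl fun k _ => Finset.sum_congr rfl fun v _ => by ring
      simp_rw [hstep, hswap]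
      -- it suffices to treat each drawn index separately
      have hk : ∀ k, errorPotential δ (n + 1) α β
          ≤ α * ∑ v, spinWeight p v * hit G v (c k * spin (v (b k)) :: a)
            + β * ∑ v, spinWeight q v * hit Gᶜ v (c k * spin (v (b k)) :: a) := by
        intro k
        rcases hpq (b k) with ⟨hp, hq⟩ | ⟨hpq', s, hs⟩
        · have hupd : ∀ s : Bool, ∀ j,
              (Function.update p (b k) (spin s) j = δ ∧ Function.update q (b k) (spin s) j = 0) ∨
              (Function.update p (b k) (spin s) j = Function.update q (b k) (spin s) j ∧
                ∃ s', Function.update p (b k) (spin s) j = spin s') := by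
            intro s j
            by_cases hj : j = b k
            · subst hj
              exact Or.inr ⟨by simp, s, by simp⟩
            · simpa [hj] using hpq j
          have h1 := ih (c k * spin true :: a) _ _ (α * (1 + δ)) β
            (mul_nonneg hα (by linarith)) hβ (hupd true)
          have h2 := ih (c k * spin false :: a) _ _ (α * (1 - δ)) β
            (mul_nonneg hα (by linarith)) hβ (hupd false)
          rw [sum_spinWeight_split p (b k) fun s v => hit G v (c k * spin s :: a),
            sum_spinWeight_split q (b k) fun s v => hit Gᶜ v (c k * spin s :: a), hp, hq,
            errorPotential_succ_eq]
          simp only [hhit]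
          linarith
        · have h1 := ih (c k * spin s :: a) p q α β hα hβ hpq
          rw [Finset.sum_congr rfl fun v _ => spinWeight_mul_of_eq_spin hs v
              fun s => hit G v (c k * spin s :: a),
            Finset.sum_congr rfl fun v _ => spinWeight_mul_of_eq_spin (hpq' ▸ hs) v
              fun s => hit Gᶜ v (c k * spin s :: a)]
          exact (errorPotential_succ_le δ n α β).trans h1
      calc errorPotential δ (n + 1) α β
          = ∑ k, (w i k).toReal * errorPotential δ (n + 1) α β := by
            rw [← Finset.sum_mul, sum_toReal_pmf, one_mul]
        _ ≤ ∑ k, (w i k).toReal *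
              (α * ∑ v, spinWeight p v * hit G v (c k * spin (v (b k)) :: a)
                + β * ∑ v, spinWeight q v * hit Gᶜ v (c k * spin (v (b k)) :: a)) :=
            Finset.sum_le_sum fun k _ => mul_le_mul_of_nonneg_left (hk k) ENNReal.toReal_nonneg
        _ = _ := by
            rw [Finset.mul_sum, Finset.mul_sum, ← Finset.sum_add_distrib]
            exact Finset.sum_congr rfl fun k _ => by ring

theorem nine_tenths_le_errorPotential {N : ℕ} (hN : 1 ≤ N) {δ : ℝ}
    (hδ : δ ^ 2 = 1 / (100 * N)) : 9 / 10 ≤ errorPotential δ N 1 1 := by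
  have hN' : (0 : ℝ) < N := by exact_mod_cast hN
  have h1 : (1 + δ ^ 2) ^ N ≤ Real.exp (1 / 100) := by
    calc (1 + δ ^ 2) ^ N ≤ Real.exp (δ ^ 2) ^ N := by
          gcongr
          linarith [Real.add_one_le_exp (δ ^ 2)]
      _ = Real.exp (1 / 100) := by
          rw [← Real.exp_nat_mul, hδ]
          congr 1
          field_simp
  have h2 : Real.exp (1 / 100) ≤ 100 / 99 := by
    have h := Real.add_one_le_exp (-(1 / 100) : ℝ)
    rw [Real.exp_neg, le_inv_comm₀ (by norm_num) (Real.exp_pos _)] at h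
    norm_num at h ⊢
    linarith
  unfold errorPotential
  linarith

/-! ### Expectations under a discrete law -/

/-- The expectation of an extended nonnegative function under a discrete law. -/
noncomputable def expectation {α : Type*} (p : PMF α) (g : α → ENNReal) : ENNReal :=
  ∑' a, p a * g a

section Expectation

variable {α β : Type*}

theorem toOuterMeasure_eq_expectation (p : PMF α) (s : Set α) :
    p.toOuterMeasure s = expectation p (s.indicator 1) := by
  rw [PMF.toOuterMeasure_apply, expectation]
  refine tsum_congr fun a => ?_
  by_cases h : a ∈ s <;> simp [h]

theorem expectation_pure (a : α) (g : α → ENNReal) : expectation (PMF.pure a) g = g a := by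
  rw [expectation, tsum_eq_single a fun b hb => by simp [PMF.pure_apply_of_ne _ _ hb]]
  simp

theorem expectation_bind (p : PMF α) (f : α → PMF β) (g : β → ENNReal) :
    expectation (p.bind f) g = expectation p fun a => expectation (f a) g := by
  simp only [expectation, PMF.bind_apply, ← ENNReal.tsum_mul_right, ← ENNReal.tsum_mul_left]
  rw [ENNReal.tsum_comm]
  simp_rw [mul_assoc]

theorem expectation_map (p : PMF α) (f : α → β) (g : β → ENNReal) :
    expectation (p.map f) g = expectation p (g ∘ f) := by
  rw [PMF.map, expectation_bind]
  simp only [Function.comp_def, expectation_pure]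

theorem expectation_mono {p : PMF α} {g g' : α → ENNReal} (h : ∀ a ∈ p.support, g a ≤ g' a) :
    expectation p g ≤ expectation p g' := by
  refine ENNReal.tsum_le_tsum fun a => ?_
  by_cases ha : p a = 0
  · simp [ha]
  · gcongr
    exact h a ((p.mem_support_iff a).mpr ha)

theorem expectation_congr {p : PMF α} {g g' : α → ENNReal} (h : ∀ a ∈ p.support, g a = g' a) :
    expectation p g = expectation p g' :=
  le_antisymm (expectation_mono fun a ha => (h a ha).le) (expectation_mono fun a ha => (h a ha).ge)

theorem expectation_const (p : PMF α) (c : ENNReal) : expectation p (fun _ => c) = c := by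
  rw [expectation, ENNReal.tsum_mul_right, p.tsum_coe, one_mul]

theorem expectation_add (p : PMF α) (g g' : α → ENNReal) :
    expectation p (fun a => g a + g' a) = expectation p g + expectation p g' := by
  simp only [expectation, mul_add, ENNReal.tsum_add]

theorem expectation_const_mul (p : PMF α) (c : ENNReal) (g : α → ENNReal) :
    expectation p (fun a => c * g a) = c * expectation p g := by
  rw [expectation, expectation, ← ENNReal.tsum_mul_left]
  exact tsum_congr fun a => by ring

theorem bind_congr_of_support {p : PMF α} {f f' : α → PMF β} (h : ∀ a ∈ p.support, f a = f' a) :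
    p.bind f = p.bind f' := by
  ext b
  exact expectation_congr (p := p) (g := fun a => f a b) (g' := fun a => f' a b)
    fun a ha => by rw [h a ha]

end Expectation

/-! ### The regret of Hedge -/

/-- The soft minimum of `L` at inverse temperature `η`, normalized so that constants are fixed. -/
noncomputable def softMin {κ : Type*} [Fintype κ] (η : ℝ) (L : κ → ℝ) : ℝ :=
  -(Real.log (∑ j, (Fintype.card κ : ℝ)⁻¹ * Real.exp (-(η * L j))) / η)

section SoftMin

variable {κ : Type*} [Fintype κ]

theorem sum_exp_pos [Nonempty κ] (η : ℝ) (L : κ → ℝ) :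
    0 < ∑ j, (Fintype.card κ : ℝ)⁻¹ * Real.exp (-(η * L j)) :=
  Finset.sum_pos (fun _ _ => mul_pos (inv_pos.mpr (by exact_mod_cast Fintype.card_pos))
    (Real.exp_pos _)) Finset.univ_nonempty

theorem sum_inv_card [Nonempty κ] : ∑ _j : κ, (Fintype.card κ : ℝ)⁻¹ = 1 := by
  have : (Fintype.card κ : ℝ) ≠ 0 := by exact_mod_cast Fintype.card_ne_zero
  rw [Finset.sum_const, Finset.card_univ, nsmul_eq_mul, mul_inv_cancel₀ this]

theorem softMin_zero [Nonempty κ] (η : ℝ) : softMin η (fun _ : κ => 0) = 0 := by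
  simp only [softMin, mul_zero, neg_zero, Real.exp_zero, mul_one]
  rw [sum_inv_card, Real.log_one, zero_div, neg_zero]

theorem softMin_le [Nonempty κ] {η : ℝ} (hη : 0 < η) (L : κ → ℝ) (j : κ) :
    softMin η L ≤ L j + Real.log (Fintype.card κ) / η := by
  have hc : (0 : ℝ) < Fintype.card κ := by exact_mod_cast Fintype.card_pos
  have h1 : (Fintype.card κ : ℝ)⁻¹ * Real.exp (-(η * L j))
      ≤ ∑ j, (Fintype.card κ : ℝ)⁻¹ * Real.exp (-(η * L j)) :=
    Finset.single_le_sum (f := fun j => (Fintype.card κ : ℝ)⁻¹ * Real.exp (-(η * L j)))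
      (fun _ _ => by positivity) (Finset.mem_univ j)
  have h2 := Real.log_le_log (by positivity) h1
  rw [Real.log_mul (by positivity) (Real.exp_pos _).ne', Real.log_inv, Real.log_exp] at h2
  rw [softMin, ← neg_div, div_le_iff₀ hη, add_mul, div_mul_cancel₀ _ hη.ne']
  linarith

/-- The soft minimum decreases with the inverse temperature, by the power mean inequality. -/
theorem softMin_anti [Nonempty κ] {η η' : ℝ} (hη' : 0 < η') (h : η' ≤ η) (L : κ → ℝ) :
    softMin η L ≤ softMin η' L := by
  have hη := hη'.trans_le h
  have hp := Real.rpow_arith_mean_le_arith_mean_rpow Finset.univ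
    (fun _ : κ => (Fintype.card κ : ℝ)⁻¹) (fun j => Real.exp (-(η' * L j)))
    (fun _ _ => by positivity) sum_inv_card (fun _ _ => (Real.exp_pos _).le)
    (p := η / η') ((one_le_div hη').mpr h)
  have he : ∀ j, Real.exp (-(η' * L j)) ^ (η / η') = Real.exp (-(η * L j)) := by
    intro j
    rw [← Real.exp_mul]
    congr 1
    field_simp
  simp_rw [he] at hp
  have hl := Real.log_le_log (Real.rpow_pos_of_pos (sum_exp_pos η' L) _) hp
  rw [Real.log_rpow (sum_exp_pos η' L)] at hl
  rw [softMin, softMin, neg_le_neg_iff, le_div_iff₀ hη]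
  calc _ = η / η' * Real.log (∑ j, (Fintype.card κ : ℝ)⁻¹ * Real.exp (-(η' * L j))) := by
        field_simp
    _ ≤ _ := hl

/-- Hoeffding's lemma for a law on a finite type. -/
theorem sum_mul_exp_le (p : PMF κ) {l : κ → ℝ} (hl : ∀ j, |l j| ≤ 1) (t : ℝ) :
    ∑ j, (p j).toReal * Real.exp (t * l j)
      ≤ Real.exp (t * ∑ j, (p j).toReal * l j + t ^ 2 / 2) := by
  let _ : MeasurableSpace κ := ⊤
  have h := (ProbabilityTheory.hasSubgaussianMGF_of_mem_Icc (μ := p.toMeasure) (X := l)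
    (a := -1) (b := 1) (measurable_from_top).aemeasurable
    (Filter.Eventually.of_forall fun j => abs_le.mp (hl j))).mgf_le t
  rw [ProbabilityTheory.mgf, PMF.integral_eq_sum, PMF.integral_eq_sum] at h
  simp only [smul_eq_mul] at h
  set m := ∑ j, (p j).toReal * l j
  have h2 : ∑ j, (p j).toReal * Real.exp (t * l j)
      = Real.exp (t * m) * ∑ j, (p j).toReal * Real.exp (t * (l j - m)) := by
    rw [Finset.mul_sum]
    refine Finset.sum_congr rfl fun j _ => ?_
    rw [mul_sub, Real.exp_sub]
    field_simp
  rw [h2, Real.exp_add]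
  refine mul_le_mul_of_nonneg_left (h.trans_eq ?_) (Real.exp_pos _).le
  norm_num

/-- The expected loss of an index drawn with weights `exp (-(η * L j))` is at most the increment of
the soft minimum, up to `η / 2`. -/
theorem sum_mul_le_softMin_sub [Nonempty κ] {η : ℝ} (hη : 0 < η) (p : PMF κ) (L l : κ → ℝ)
    (hl : ∀ j, |l j| ≤ 1)
    (hp : ∀ j, (p j).toReal = Real.exp (-(η * L j)) / ∑ i, Real.exp (-(η * L i))) :
    ∑ j, (p j).toReal * l j ≤ softMin η (fun j => L j + l j) - softMin η L + η / 2 := by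
  have hc : (0 : ℝ) < (Fintype.card κ : ℝ)⁻¹ := inv_pos.mpr (by exact_mod_cast Fintype.card_pos)
  have hS : 0 < ∑ i, Real.exp (-(η * L i)) :=
    Finset.sum_pos (fun _ _ => Real.exp_pos _) Finset.univ_nonempty
  have h := sum_mul_exp_le p hl (-η)
  have h1 : ∑ j, (p j).toReal * Real.exp (-η * l j)
      = (∑ j, (Fintype.card κ : ℝ)⁻¹ * Real.exp (-(η * (L j + l j))))
        / ∑ j, (Fintype.card κ : ℝ)⁻¹ * Real.exp (-(η * L j)) := by
    rw [← Finset.mul_sum, ← Finset.mul_sum, mul_div_mul_left _ _ hc.ne', Finset.sum_div]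
    refine Finset.sum_congr rfl fun j _ => ?_
    rw [hp, div_mul_eq_mul_div, ← Real.exp_add]
    congr 2
    ring
  rw [h1] at h
  have hlog := Real.log_le_log (div_pos (sum_exp_pos η _) (sum_exp_pos η L)) h
  rw [Real.log_exp, Real.log_div (sum_exp_pos η _).ne' (sum_exp_pos η L).ne'] at hlog
  have h3 : η * ∑ j, (p j).toReal * l j ≤ η * (softMin η (fun j => L j + l j) - softMin η L
      + η / 2) := by
    have e1 : ∀ L : κ → ℝ, η * softMin η L
        = -Real.log (∑ j, (Fintype.card κ : ℝ)⁻¹ * Real.exp (-(η * L j))) := by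
      intro L
      rw [softMin]
      field_simp
    rw [mul_add, mul_sub, e1, e1]
    linarith
  exact le_of_mul_le_mul_left h3 hη

end SoftMin

section Hedge

variable {X : Type*} {m : ℕ} [NeZero m]

/-- The total loss of `f j` on the given pairs. -/
noncomputable def cumLoss (f : Fin m → X → ℝ) (mem : List (X × (ℝ → ℝ))) (j : Fin m) : ℝ :=
  (mem.map fun r => r.2 (f j r.1)).sum

theorem toReal_hedgeIndex (f : Fin m → X → ℝ) (mem : List (X × (ℝ → ℝ))) (j : Fin m) :
    (hedgeIndex f mem j).toReal = hedgeWeight f mem j / ∑ i, hedgeWeight f mem i := by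
  have hpos : ∀ i, 0 ≤ hedgeWeight f mem i := fun i => (Real.exp_pos _).le
  rw [hedgeIndex, PMF.normalize_apply, tsum_fintype, ← ENNReal.ofReal_sum_of_nonneg
    fun i _ => hpos i, ENNReal.toReal_mul, ENNReal.toReal_inv, ENNReal.toReal_ofReal (hpos j),
    ENNReal.toReal_ofReal (Finset.sum_nonneg fun i _ => hpos i), div_eq_mul_inv]

theorem length_of_mem_support_learnerRun (A : OnlineLearner X) {C : Set (ℝ → ℝ)}
    (adv : List (Play X) → X × C) (T : ℕ) :
    ∀ h ∈ (learnerRun A adv T).support, h.length = T := by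
  induction T with
  | zero =>
    intro h hh
    simp only [learnerRun, PMF.mem_support_pure_iff] at hh
    simp [hh]
  | succ T ih =>
    intro h hh
    simp only [learnerRun, PMF.mem_support_bind_iff, PMF.mem_support_map_iff] at hh
    obtain ⟨h', hh', v, _, rfl⟩ := hh
    simp [ih h' hh']

/-- The learning rate of Hedge after `n` rounds of feedback. -/
noncomputable def hedgeRate (m n : ℕ) : ℝ := Real.sqrt (Real.log m / (n + 1))

/-- The exponential supermartingale of Hedge at the parameter `t`: the realized loss is compared
with the soft minimum of the losses of the comparators. -/
noncomputable def hedgePotential (f : Fin m → X → ℝ) (t : ℝ) (h : List (Play X)) : ℝ :=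
  Real.exp (t * ((h.map fun r => r.loss r.prediction).sum
      - softMin (hedgeRate m h.length) (cumLoss f (h.map fun r => (r.example_, r.loss))))
    - t ^ 2 * h.length / 2 - t * (Real.sqrt (Real.log m) * Real.sqrt h.length))

theorem half_hedgeRate_le (m n : ℕ) :
    hedgeRate m n / 2
      ≤ Real.sqrt (Real.log m) * (Real.sqrt ((n + 1 : ℕ) : ℝ) - Real.sqrt n) := by
  have hn : (0 : ℝ) ≤ n := n.cast_nonneg
  have hs : 0 < Real.sqrt ((n : ℝ) + 1) := Real.sqrt_pos.mpr (by linarith)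
  rw [hedgeRate, Real.sqrt_div' _ (by linarith), div_div, div_eq_mul_inv]
  refine mul_le_mul_of_nonneg_left ?_ (Real.sqrt_nonneg _)
  push_cast
  rw [inv_eq_one_div, div_le_iff₀ (by positivity)]
  nlinarith [Real.sq_sqrt hn, Real.sq_sqrt (show (0 : ℝ) ≤ n + 1 by linarith),
    sq_nonneg (Real.sqrt ((n : ℝ) + 1) - Real.sqrt n)]

theorem expectation_hedgePotential_cons_le (hm : 1 < m) {f : Fin m → X → ℝ}
    (hf : ∀ j x, |f j x| ≤ 1) {t : ℝ} (ht : 0 ≤ t) (h : List (Play X)) (x : X)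
    (ℓ : linearLosses) :
    expectation (hedge f (h.map fun r => (r.example_, r.loss)) x)
        (fun v => ENNReal.ofReal (hedgePotential f t (⟨x, ℓ.1, v⟩ :: h)))
      ≤ ENNReal.ofReal (hedgePotential f t h) := by
  obtain ⟨_, g, hg, rfl⟩ := ℓ
  set mem := h.map fun r => (r.example_, r.loss) with hmem
  set n := h.length with hn
  have hlen : mem.length = n := by simp [hmem, hn]
  have hlogm : 0 < Real.log m := Real.log_pos (by exact_mod_cast hm)
  set η := hedgeRate m n with hη
  have hηpos : 0 < η := Real.sqrt_pos.mpr (by positivity)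
  have hη'pos : 0 < hedgeRate m (n + 1) := Real.sqrt_pos.mpr (by positivity)
  have hηη' : hedgeRate m (n + 1) ≤ η := by
    refine Real.sqrt_le_sqrt ?_
    push_cast
    gcongr
    linarith
  set L := cumLoss f mem with hL
  set l : Fin m → ℝ := fun j => g * f j x with hl
  have hl1 : ∀ j, |l j| ≤ 1 := fun j => by
    rw [hl, abs_mul]
    exact mul_le_one₀ hg (abs_nonneg _) (hf j x)
  set p := hedgeIndex f mem with hp
  have hpj : ∀ j, (p j).toReal = Real.exp (-(η * L j)) / ∑ i, Real.exp (-(η * L i)) := by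
    intro j
    have hw : ∀ i, hedgeWeight f mem i = Real.exp (-(η * L i)) := by
      intro i
      rw [hedgeWeight, hlen]
      rfl
    simp_rw [hp, toReal_hedgeIndex, hw]
  have hmean := sum_mul_le_softMin_sub hηpos p L l hl1 hpj
  have hcons : (fun j => L j + l j) = cumLoss f ((x, fun y => g * y) :: mem) := by
    funext j
    simp [cumLoss, hl, hL, add_comm]
  rw [hcons] at hmean
  have hanti := softMin_anti hη'pos hηη' (cumLoss f ((x, fun y => g * y) :: mem))
  have hrate := half_hedgeRate_le m n
  set S := (h.map fun r => r.loss r.prediction).sum with hS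
  -- the new potential as a function of the drawn index
  set D := t * (S - softMin (hedgeRate m (n + 1)) (cumLoss f ((x, fun y => g * y) :: mem)))
    - t ^ 2 * ((n + 1 : ℕ) : ℝ) / 2
    - t * (Real.sqrt (Real.log m) * Real.sqrt ((n + 1 : ℕ) : ℝ)) with hD
  have hnew : ∀ j, hedgePotential f t (⟨x, fun y => g * y, f j x⟩ :: h)
      = Real.exp D * Real.exp (t * l j) := by
    intro j
    rw [hedgePotential, ← Real.exp_add]
    simp only [List.map_cons, List.sum_cons, List.length_cons, hD, hl, ← hS, ← hmem, ← hn]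
    congr 1
    ring
  rw [hedge, expectation_map, expectation, tsum_fintype]
  simp only [Function.comp_apply, hnew, ← hp]
  calc ∑ j, p j * ENNReal.ofReal (Real.exp D * Real.exp (t * l j))
      = ENNReal.ofReal (∑ j, (p j).toReal * (Real.exp D * Real.exp (t * l j))) := by
        rw [ENNReal.ofReal_sum_of_nonneg fun j _ => by positivity]
        refine Finset.sum_congr rfl fun j _ => ?_
        rw [ENNReal.ofReal_mul ENNReal.toReal_nonneg, ENNReal.ofReal_toReal (p.apply_ne_top j)]
    _ ≤ ENNReal.ofReal (hedgePotential f t h) := by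
        refine ENNReal.ofReal_le_ofReal ?_
        calc ∑ j, (p j).toReal * (Real.exp D * Real.exp (t * l j))
            = Real.exp D * ∑ j, (p j).toReal * Real.exp (t * l j) := by
              rw [Finset.mul_sum]
              exact Finset.sum_congr rfl fun j _ => by ring
          _ ≤ Real.exp D * Real.exp (t * ∑ j, (p j).toReal * l j + t ^ 2 / 2) :=
              mul_le_mul_of_nonneg_left (sum_mul_exp_le p hl1 t) (Real.exp_pos _).le
          _ ≤ hedgePotential f t h := by
              rw [← Real.exp_add, hedgePotential, Real.exp_le_exp, ← hn, ← hmem, ← hL, ← hη, ← hS]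
              have := mul_le_mul_of_nonneg_left
                (hmean.trans (add_le_add (sub_le_sub_right hanti _) hrate)) ht
              simp only [hD]
              push_cast at this ⊢
              nlinarith

theorem expectation_hedgePotential_le (hm : 1 < m) {f : Fin m → X → ℝ}
    (hf : ∀ j x, |f j x| ≤ 1) {t : ℝ} (ht : 0 ≤ t)
    (adv : List (Play X) → X × linearLosses) (T : ℕ) :
    expectation (learnerRun (hedge f) adv T) (fun h => ENNReal.ofReal (hedgePotential f t h))
      ≤ 1 := by
  induction T with
  | zero =>
    rw [learnerRun, expectation_pure]
    have : cumLoss f [] = fun _ => 0 := by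
      funext j
      simp [cumLoss]
    simp [hedgePotential, this, softMin_zero]
  | succ T ih =>
    rw [learnerRun, expectation_bind]
    refine le_trans (expectation_mono fun h _ => ?_) ih
    rw [expectation_map]
    exact expectation_hedgePotential_cons_le hm hf ht h (adv h).1 (adv h).2

/-- On the event that the regret exceeds the bound, the potential at
`t = √(log (1 / δ) / T)` is at least `1 / δ`. -/
theorem inv_le_hedgePotential (hm : 1 < m) (f : Fin m → X → ℝ) {δ : ℝ} (hδ0 : 0 < δ)
    (hδ1 : δ < 1) {T : ℕ} (hT : 0 < T) {h : List (Play X)} (hlen : h.length = T)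
    (hreg : 4 * (Real.sqrt (T * Real.log m) + Real.sqrt (T * Real.log (1 / δ)))
      < regret (Set.range f) h) :
    δ⁻¹ ≤ hedgePotential f (Real.sqrt (Real.log (1 / δ) / T)) h := by
  have hlogm : 0 < Real.log m := Real.log_pos (by exact_mod_cast hm)
  have hT' : (0 : ℝ) < T := by exact_mod_cast hT
  have hT1 : (1 : ℝ) ≤ T := by exact_mod_cast hT
  have hlogδ : 0 < Real.log (1 / δ) := Real.log_pos (by rwa [one_div, one_lt_inv₀ hδ0])
  set S := (h.map fun r => r.loss r.prediction).sum with hS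
  set R := 4 * (Real.sqrt (T * Real.log m) + Real.sqrt (T * Real.log (1 / δ))) with hR
  have : Nonempty (Set.range f) := ⟨⟨f 0, 0, rfl⟩⟩
  obtain ⟨⟨_, j, rfl⟩, hj⟩ := exists_lt_of_ciInf_lt (lt_sub_comm.mp hreg)
  have hj' : cumLoss f (h.map fun r => (r.example_, r.loss)) j < S - R := by
    simpa [cumLoss, List.map_map, Function.comp_def] using hj
  have hη : 0 < hedgeRate m T := Real.sqrt_pos.mpr (by positivity)
  have hsoft := softMin_le hη (cumLoss f (h.map fun r => (r.example_, r.loss))) j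
  rw [Fintype.card_fin] at hsoft
  set a := Real.sqrt (T * Real.log m) with ha
  set b := Real.sqrt (T * Real.log (1 / δ)) with hb
  have ha0 : 0 ≤ a := Real.sqrt_nonneg _
  have hb0 : 0 ≤ b := Real.sqrt_nonneg _
  have hrate : Real.log m / hedgeRate m T ≤ 2 * a := by
    rw [div_le_iff₀ hη]
    have h1 : 2 * a * hedgeRate m T
        = Real.sqrt (4 * (T * Real.log m) * (Real.log m / (T + 1))) := by
      rw [Real.sqrt_mul (by positivity), Real.sqrt_mul (by norm_num),
        show (4 : ℝ) = 2 ^ 2 by norm_num, Real.sqrt_sq (by norm_num)]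
      rfl
    rw [h1]
    refine Real.le_sqrt_of_sq_le ?_
    rw [mul_div_assoc', le_div_iff₀ (by linarith)]
    nlinarith [mul_nonneg (sq_nonneg (Real.log m)) (show (0 : ℝ) ≤ 3 * T - 1 by linarith)]
  set t := Real.sqrt (Real.log (1 / δ) / T) with ht
  have ht0 : 0 ≤ t := Real.sqrt_nonneg _
  have htb : t * b = Real.log (1 / δ) := by
    rw [ht, hb, ← Real.sqrt_mul (by positivity), div_mul_eq_mul_div, mul_left_comm,
      mul_div_cancel_left₀ _ hT'.ne', Real.sqrt_mul_self hlogδ.le]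
  have htt : t ^ 2 * T = Real.log (1 / δ) := by
    rw [ht, Real.sq_sqrt (by positivity), div_mul_cancel₀ _ hT'.ne']
  rw [← Real.exp_log (inv_pos.mpr hδ0), hedgePotential, Real.exp_le_exp, hlen, ← one_div, ← hS,
    ← Real.sqrt_mul hlogm.le, mul_comm (Real.log m), ← ha]
  have hdiff : 2 * a + 4 * b
      ≤ S - softMin (hedgeRate m T) (cumLoss f (h.map fun r => (r.example_, r.loss))) := by
    linarith
  have h1 := mul_le_mul_of_nonneg_left hdiff ht0
  have h2 := mul_nonneg ht0 ha0
  linarith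

/-- The anytime regret bound of Hedge, with high probability against adaptive adversaries. -/
theorem isOnlineLearner_hedge (hm : 1 < m) {f : Fin m → X → ℝ} (hf : ∀ j x, |f j x| ≤ 1) :
    IsOnlineLearner (hedge f) (Set.range f) linearLosses
      (fun T δ => 4 * (Real.sqrt (T * Real.log m) + Real.sqrt (T * Real.log (1 / δ)))) := by
  intro adv T δ hδ0 hδ1
  set p := learnerRun (hedge f) adv T with hp
  set R := 4 * (Real.sqrt (T * Real.log m) + Real.sqrt (T * Real.log (1 / δ))) with hR
  set good := {h | regret (Set.range f) h ≤ R} with hgood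
  have huniv : p.toOuterMeasure Set.univ = 1 :=
    (PMF.toOuterMeasure_apply_eq_one_iff _ _).mpr (Set.subset_univ _)
  suffices hbad : p.toOuterMeasure goodᶜ ≤ ENNReal.ofReal δ by
    rw [ENNReal.ofReal_sub _ hδ0.le, ENNReal.ofReal_one, tsub_le_iff_right, ← huniv,
      ← Set.union_compl_self good]
    exact (measure_union_le _ _).trans (add_le_add_right hbad _)
  rcases Nat.eq_zero_or_pos T with rfl | hT
  · have : Nonempty (Set.range f) := ⟨⟨f 0, 0, rfl⟩⟩
    have h0 : ([] : List (Play X)) ∈ good := by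
      simp only [hgood, Set.mem_ofPred_eq, regret, List.map_nil, List.sum_nil, ciInf_const,
        sub_zero]
      positivity
    rw [hp, learnerRun, PMF.toOuterMeasure_pure_apply, if_neg (by simpa using h0)]
    exact zero_le
  · set t := Real.sqrt (Real.log (1 / δ) / T) with ht
    have key : ∀ h ∈ p.support, goodᶜ.indicator (1 : List (Play X) → ENNReal) h
        ≤ ENNReal.ofReal δ * ENNReal.ofReal (hedgePotential f t h) := by
      intro h hh
      by_cases hg : h ∈ goodᶜ
      · rw [Set.indicator_of_mem hg, ← ENNReal.ofReal_mul hδ0.le, Pi.one_apply,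
          ENNReal.one_le_ofReal, ← div_le_iff₀' hδ0, one_div]
        exact inv_le_hedgePotential hm f hδ0 hδ1 hT (length_of_mem_support_learnerRun _ _ _ h hh)
          (not_le.mp hg)
      · rw [Set.indicator_of_notMem hg]
        exact zero_le
    rw [toOuterMeasure_eq_expectation]
    calc _ ≤ _ := expectation_mono key
      _ = ENNReal.ofReal δ * expectation p fun h => ENNReal.ofReal (hedgePotential f t h) :=
          expectation_const_mul _ _ _
      _ ≤ ENNReal.ofReal δ * 1 := by
          gcongr
          exact expectation_hedgePotential_le hm hf (Real.sqrt_nonneg _) adv T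
      _ = ENNReal.ofReal δ := mul_one _

end Hedge

/-! ### Resampling one coordinate of an infinite product -/

/-- Redrawing one coordinate does not change the law of an independent sequence. -/
theorem lintegral_infinitePi_resample {Y : Type*} [MeasurableSpace Y] (μ : Measure Y)
    [IsProbabilityMeasure μ] (n : ℕ) {H : (ℕ → Y) → ENNReal} (hH : Measurable H) :
    ∫⁻ ω, H ω ∂Measure.infinitePi (fun _ : ℕ => μ)
      = ∫⁻ ω, ∫⁻ a, H (Function.update ω n a) ∂μ ∂Measure.infinitePi (fun _ : ℕ => μ) := by
  set ν := Measure.infinitePi (fun _ : ℕ => μ) with hν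
  have hmeas : Measurable fun q : (ℕ → Y) × Y => Function.update q.1 n q.2 := measurable_update'
  have hmap : (ν.prod μ).map (fun q : (ℕ → Y) × Y => Function.update q.1 n q.2) = ν := by
    refine Measure.eq_infinitePi (fun _ : ℕ => μ) fun s t ht => ?_
    rw [Measure.map_apply hmeas (MeasurableSet.pi s.countable_toSet fun i _ => ht i)]
    by_cases hn : n ∈ s
    · have hpre : (fun q : (ℕ → Y) × Y => Function.update q.1 n q.2) ⁻¹' Set.pi s t
          = (Set.pi (s.erase n : Finset ℕ) t) ×ˢ t n := by
        ext ⟨ω, a⟩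
        simp only [Set.mem_preimage, Set.mem_pi, Set.mem_prod, Finset.mem_coe, Finset.mem_erase]
        constructor
        · intro h
          refine ⟨fun i hi => ?_, ?_⟩
          · simpa [hi.1] using h i hi.2
          · simpa using h n hn
        · rintro ⟨h1, h2⟩ i hi
          by_cases hin : i = n
          · subst hin
            simpa using h2
          · simpa [hin] using h1 i ⟨hin, hi⟩
      rw [hpre, Measure.prod_prod, hν, Measure.infinitePi_pi _ fun i _ => ht i,
        Finset.prod_erase_mul _ _ hn]
    · have hpre : (fun q : (ℕ → Y) × Y => Function.update q.1 n q.2) ⁻¹' Set.pi s t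
          = (Set.pi s t) ×ˢ Set.univ := by
        ext ⟨ω, a⟩
        simp only [Set.mem_preimage, Set.mem_pi, Set.mem_prod, Finset.mem_coe, Set.mem_univ,
          and_true]
        refine forall₂_congr fun i hi => ?_
        rw [Function.update_of_ne (fun h : i = n => hn (h ▸ hi))]
      rw [hpre, Measure.prod_prod, hν, Measure.infinitePi_pi _ fun i _ => ht i, measure_univ,
        mul_one]
  rw [← lintegral_prod (fun q : (ℕ → Y) × Y => H (Function.update q.1 n q.2))
    (hH.comp hmeas).aemeasurable, ← lintegral_map hH hmeas, hmap]

/-- A function of finitely many coordinates in a finite discrete space is measurable. -/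
theorem measurable_of_forall_lt {Y β : Type*} [MeasurableSpace Y] [Finite Y]
    [MeasurableSingletonClass Y] [Nonempty Y] [MeasurableSpace β] (n : ℕ) {H : (ℕ → Y) → β}
    (hH : ∀ ω ω' : ℕ → Y, (∀ s < n, ω s = ω' s) → H ω = H ω') : Measurable H := by
  have h : H = (fun u : Fin n → Y => H fun s => if h : s < n then u ⟨s, h⟩
      else Classical.arbitrary Y) ∘ fun ω s => ω s := by
    funext ω
    refine hH _ _ fun s hs => ?_
    simp [hs]
  rw [h]
  exact Measurable.of_discrete.comp (by fun_prop)

/-! ### The run of a booster -/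

section Run

variable {X : Type*}

theorem answersLaw_congr {A A' : OnlineLearner X} {mem : ℕ → List (X × (ℝ → ℝ))} {x : X}
    (h : ∀ i, A (mem i) x = A' (mem i) x) (ask : List ℝ → Option ℕ) (n : ℕ) :
    ∀ a, answersLaw A mem x ask n a = answersLaw A' mem x ask n a := by
  induction n with
  | zero => exact fun a => rfl
  | succ n ih =>
    intro a
    rcases hask : ask a with _ | i
    · simp only [answersLaw, hask]
    · simp only [answersLaw, hask, h, ih]

/-- The copies have only received examples of past rounds. -/
theorem exists_lt_of_mem_memory (A : OnlineLearner X) (N : ℕ) (B : Booster X) (x : ℕ → X)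
    (ℓ : ℕ → ℝ → ℝ) (T : ℕ) : ∀ st ∈ (boostRun A N B x ℓ T).support, ∀ i, ∀ r ∈ st.memory i,
      ∃ s < T, r.1 = x s := by
  induction T with
  | zero =>
    intro st hst
    simp only [boostRun, PMF.mem_support_pure_iff] at hst
    subst hst
    simp
  | succ T ih =>
    intro st hst i r hr
    simp only [boostRun, PMF.mem_support_bind_iff, PMF.mem_support_map_iff] at hst
    obtain ⟨st', hst', a, _, rfl⟩ := hst
    simp only [nextState] at hr
    split at hr
    · obtain ⟨s, hs, h⟩ := ih st' hst' i r hr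
      exact ⟨s, hs.trans T.lt_succ_self, h⟩
    · rcases List.mem_cons.mp hr with rfl | hr
      · exact ⟨T, T.lt_succ_self, rfl⟩
      · obtain ⟨s, hs, h⟩ := ih st' hst' i r hr
        exact ⟨s, hs.trans T.lt_succ_self, h⟩

/-- The examples and losses of the rounds are the prescribed ones. -/
theorem sum_rounds_eq (A : OnlineLearner X) (N : ℕ) (B : Booster X) (x : ℕ → X)
    (ℓ : ℕ → ℝ → ℝ) (G : X → (ℝ → ℝ) → ℝ) (T : ℕ) :
    ∀ st ∈ (boostRun A N B x ℓ T).support,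
      (st.rounds.map fun r => G r.example_ r.loss).sum = ∑ t ∈ Finset.range T, G (x t) (ℓ t) := by
  induction T with
  | zero =>
    intro st hst
    simp only [boostRun, PMF.mem_support_pure_iff] at hst
    subst hst
    simp
  | succ T ih =>
    intro st hst
    simp only [boostRun, PMF.mem_support_bind_iff, PMF.mem_support_map_iff] at hst
    obtain ⟨st', hst', a, _, rfl⟩ := hst
    simp only [nextState, List.map_cons, List.sum_cons, ih st' hst', Finset.sum_range_succ]
    ring

theorem exists_loss_eq (A : OnlineLearner X) (N : ℕ) (B : Booster X) (x : ℕ → X)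
    (ℓ : ℕ → ℝ → ℝ) (T : ℕ) : ∀ st ∈ (boostRun A N B x ℓ T).support, ∀ r ∈ st.rounds,
      ∃ t, r.loss = ℓ t := by
  induction T with
  | zero =>
    intro st hst
    simp only [boostRun, PMF.mem_support_pure_iff] at hst
    subst hst
    simp
  | succ T ih =>
    intro st hst r hr
    simp only [boostRun, PMF.mem_support_bind_iff, PMF.mem_support_map_iff] at hst
    obtain ⟨st', hst', a, _, rfl⟩ := hst
    rcases List.mem_cons.mp hr with rfl | hr
    · exact ⟨T, rfl⟩
    · exact ih st' hst' r hr

/-- The first `T` rounds depend only on what the learner answers on these rounds. -/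
theorem boostRun_congr {A A' : OnlineLearner X} (N : ℕ) (B : Booster X) (x : ℕ → X)
    {ℓ ℓ' : ℕ → ℝ → ℝ} (T : ℕ) (hℓ : ∀ t < T, ℓ t = ℓ' t)
    (hA : ∀ t < T, ∀ mem : List (X × (ℝ → ℝ)), (∀ r ∈ mem, ∃ s < t, r.1 = x s) →
      A mem (x t) = A' mem (x t)) :
    boostRun A N B x ℓ T = boostRun A' N B x ℓ' T := by
  induction T with
  | zero => rfl
  | succ T ih =>
    rw [boostRun, boostRun, ← ih (fun t ht => hℓ t (ht.trans T.lt_succ_self))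
      fun t ht => hA t (ht.trans T.lt_succ_self), hℓ T T.lt_succ_self]
    refine bind_congr_of_support fun st hst => ?_
    rw [answersLaw_congr fun i => hA T T.lt_succ_self _
      (exists_lt_of_mem_memory A N B x ℓ T st hst i)]

/-- The number of rounds in which the loss is at least `θ`. -/
noncomputable def mistakes (θ : ℝ) (h : List (Round X)) : ℝ :=
  (h.map fun r => if θ ≤ r.loss r.prediction then (1 : ℝ) else 0).sum

theorem mistakes_nonneg (θ : ℝ) (h : List (Round X)) : 0 ≤ mistakes θ h := by
  refine List.sum_nonneg fun a ha => ?_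
  obtain ⟨r, _, rfl⟩ := List.mem_map.mp ha
  split_ifs <;> norm_num

theorem mistakes_le_length (θ : ℝ) (h : List (Round X)) : mistakes θ h ≤ h.length := by
  induction h with
  | nil => simp [mistakes]
  | cons r h ih =>
    simp only [mistakes, List.map_cons, List.sum_cons, List.length_cons, Nat.cast_add,
      Nat.cast_one] at ih ⊢
    split_ifs <;> linarith

theorem mul_mistakes_le (θ : ℝ) (h : List (Round X)) (hl : ∀ r ∈ h, 0 ≤ r.loss r.prediction) :
    θ * mistakes θ h ≤ (h.map fun r => r.loss r.prediction).sum := by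
  induction h with
  | nil => simp [mistakes]
  | cons r h ih =>
    have h1 := ih fun r hr => hl r (List.mem_cons_of_mem _ hr)
    have h2 := hl r List.mem_cons_self
    simp only [mistakes, List.map_cons, List.sum_cons] at h1 ⊢
    split_ifs with h3 <;> linarith

/-- The probability of a mistake in round `T`, given the state before it. -/
noncomputable def mistakeProb (A : OnlineLearner X) (N : ℕ) (B : Booster X) (x : X) (ℓ : ℝ → ℝ)
    (θ : ℝ) (st : RunState X) : ENNReal :=
  (answersLaw A st.memory x (B.call st.rounds x) N []).toOuterMeasure
    {a | θ ≤ ℓ (B.predict st.rounds x a)}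

theorem expectation_mistakes_succ (A : OnlineLearner X) (N : ℕ) (B : Booster X) (x : ℕ → X)
    (ℓ : ℕ → ℝ → ℝ) (θ : ℝ) (T : ℕ) :
    expectation (boostRun A N B x ℓ (T + 1)) (fun st => ENNReal.ofReal (mistakes θ st.rounds))
      = expectation (boostRun A N B x ℓ T) (fun st => ENNReal.ofReal (mistakes θ st.rounds))
        + expectation (boostRun A N B x ℓ T) (mistakeProb A N B (x T) (ℓ T) θ) := by
  rw [boostRun, expectation_bind, ← expectation_add]
  refine congrArg _ (funext fun st => ?_)
  rw [expectation_map, mistakeProb, toOuterMeasure_eq_expectation,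
    ← expectation_const (answersLaw A st.memory (x T) (B.call st.rounds (x T)) N [])
      (ENNReal.ofReal (mistakes θ st.rounds)), ← expectation_add]
  refine congrArg _ (funext fun a => ?_)
  by_cases h : θ ≤ ℓ T (B.predict st.rounds (x T) a)
  · have : a ∈ {a | θ ≤ ℓ T (B.predict st.rounds (x T) a)} := h
    rw [Set.indicator_of_mem this, Pi.one_apply, ← ENNReal.ofReal_one,
      ← ENNReal.ofReal_add (mistakes_nonneg _ _) zero_le_one]
    simp [nextState, mistakes, h, add_comm]
  · have : a ∉ {a | θ ≤ ℓ T (B.predict st.rounds (x T) a)} := h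
    rw [Set.indicator_of_notMem this, add_zero]
    simp [nextState, mistakes, h]

/-- If the regret is small then there are few mistakes or the comparator `k` is bad. -/
theorem mistakes_le_of_regret_lt {A : OnlineLearner X} {N : ℕ} {B : Booster X} {x : ℕ → X}
    {ℓ : ℕ → ℝ → ℝ} (hℓ : ∀ t z, 0 ≤ ℓ t z) {T : ℕ} {st : RunState X}
    (hst : st ∈ (boostRun A N B x ℓ T).support) {K : Set (X → ℝ)} {k : X → ℝ} (hk : k ∈ K)
    {θ r : ℝ} (hr : regret K (st.rounds.map Round.toPlay) < r) :
    θ * mistakes θ st.rounds ≤ r + ∑ t ∈ Finset.range T, ℓ t (k (x t)) := by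
  have hsum : ∀ k : X → ℝ, ((st.rounds.map Round.toPlay).map fun r => r.loss (k r.example_)).sum
      = ∑ t ∈ Finset.range T, ℓ t (k (x t)) := by
    intro k
    rw [List.map_map]
    exact sum_rounds_eq A N B x ℓ (fun x l => l (k x)) T st hst
  have hbdd : BddBelow (Set.range fun k : K =>
      ((st.rounds.map Round.toPlay).map fun r => r.loss (k.1 r.example_)).sum) := by
    refine ⟨0, ?_⟩
    rintro _ ⟨k, rfl⟩
    simp only [hsum]
    exact Finset.sum_nonneg fun t _ => hℓ _ _
  have hinf := ciInf_le hbdd ⟨k, hk⟩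
  have hm := mul_mistakes_le θ st.rounds fun r hr => by
    obtain ⟨t, ht⟩ := exists_loss_eq A N B x ℓ T st hst r hr
    rw [ht]
    exact hℓ _ _
  rw [regret, List.map_map] at hr
  simp only [hsum] at hinf
  simp only [Function.comp_def] at hr
  simp only [hsum] at hr
  linarith

end Run

/-! ### The random setting -/

section Setting

/-- The label of a round: `δ` or `0`. -/
noncomputable def label (δ : ℝ) (b : Bool) : ℝ := if b then δ else 0

theorem label_mem {δ : ℝ} (h0 : 0 ≤ δ) (h1 : δ ≤ 1) (b : Bool) :
    label δ b ∈ Set.Icc (0 : ℝ) 1 := by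
  cases b <;> simp [label, h0, h1]

variable {ι : Type*}

theorem roundWeight_nonneg [Fintype ι] {δ : ℝ} (h0 : 0 ≤ δ) (h1 : δ ≤ 1) (u : Bool × (ι → Bool)) :
    0 ≤ spinWeight (fun _ => label δ u.1) u.2 / 2 := by
  refine div_nonneg (spinWeight_nonneg (fun _ => ?_) _) zero_le_two
  obtain ⟨h2, h3⟩ := label_mem h0 h1 u.1
  exact abs_le.mpr ⟨by linarith, h3⟩

theorem sum_roundWeight_mul [Fintype ι] [DecidableEq ι] (δ : ℝ) (g : Bool × (ι → Bool) → ℝ) :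
    ∑ u : Bool × (ι → Bool), spinWeight (fun _ => label δ u.1) u.2 / 2 * g u
      = (∑ v, spinWeight (fun _ => δ) v * g (true, v)
        + ∑ v, spinWeight (fun _ => 0) v * g (false, v)) / 2 := by
  rw [Fintype.sum_prod_type, Fintype.sum_bool, add_div, Finset.sum_div, Finset.sum_div]
  congr 1 <;> exact Finset.sum_congr rfl fun v _ => by simp only [label]; simp; ring

/-- The law of one round: a fair bit selects the label `δ` or `0`, and given the label the signs
are independent with mean equal to the label. -/
noncomputable def roundLaw (ι : Type*) [Fintype ι] [DecidableEq ι] {δ : ℝ} (h0 : 0 ≤ δ)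
    (h1 : δ ≤ 1) : PMF (Bool × (ι → Bool)) :=
  PMF.ofFintype (fun u => ENNReal.ofReal (spinWeight (fun _ => label δ u.1) u.2 / 2)) <| by
    rw [← ENNReal.ofReal_sum_of_nonneg fun u _ => roundWeight_nonneg h0 h1 u]
    have h := sum_roundWeight_mul (ι := ι) δ fun _ => 1
    simp only [mul_one, sum_spinWeight] at h
    rw [h]
    norm_num

theorem lintegral_roundLaw [Fintype ι] [DecidableEq ι] {δ : ℝ} (h0 : 0 ≤ δ) (h1 : δ ≤ 1)
    {g : Bool × (ι → Bool) → ℝ}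
    (hg : ∀ u, 0 ≤ g u) :
    ∫⁻ u, ENNReal.ofReal (g u) ∂(roundLaw ι h0 h1).toMeasure
      = ENNReal.ofReal ((∑ v, spinWeight (fun _ => δ) v * g (true, v)
        + ∑ v, spinWeight (fun _ => 0) v * g (false, v)) / 2) := by
  rw [lintegral_fintype, ← sum_roundWeight_mul, ENNReal.ofReal_sum_of_nonneg
    fun u _ => mul_nonneg (roundWeight_nonneg h0 h1 u) (hg u)]
  refine Finset.sum_congr rfl fun u _ => ?_
  rw [PMF.toMeasure_apply_singleton _ _ (measurableSet_singleton u), roundLaw,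
    PMF.ofFintype_apply, mul_comm, ENNReal.ofReal_mul (roundWeight_nonneg h0 h1 u)]

/-- The law of the whole setting: independent rounds. -/
noncomputable def settingLaw (ι : Type*) [Fintype ι] [DecidableEq ι] {δ : ℝ} (h0 : 0 ≤ δ)
    (h1 : δ ≤ 1) : Measure (ℕ → Bool × (ι → Bool)) :=
  Measure.infinitePi fun _ => (roundLaw ι h0 h1).toMeasure

instance [Fintype ι] [DecidableEq ι] {δ : ℝ} (h0 : 0 ≤ δ) (h1 : δ ≤ 1) :
    IsProbabilityMeasure (settingLaw ι h0 h1) := by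
  unfold settingLaw
  infer_instance

variable {m : ℕ} (e : Fin m ≃ SignType × ι)

/-- The class of the setting: for each `j : ι` the function whose value at `t` is the `j`-th sign of
round `t`, its negative, and zero. -/
noncomputable def signClass (ω : ℕ → Bool × (ι → Bool)) (k : Fin m) (t : ℕ) : ℝ :=
  ((e k).1 : ℝ) * spin ((ω t).2 (e k).2)

theorem abs_signClass_le (ω : ℕ → Bool × (ι → Bool)) (k : Fin m) (t : ℕ) :
    |signClass e ω k t| ≤ 1 := by
  rw [signClass, abs_mul, abs_spin, mul_one]
  cases (e k).1 <;> simp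


theorem signClass_congr {ω ω' : ℕ → Bool × (ι → Bool)} {t : ℕ} (h : ω t = ω' t) (k : Fin m) :
    signClass e ω k t = signClass e ω' k t := by
  rw [signClass, signClass, h]

theorem neg_signClass_mem (ω : ℕ → Bool × (ι → Bool)) (k : Fin m) :
    -signClass e ω k ∈ Set.range (signClass e ω) := by
  refine ⟨e.symm (-(e k).1, (e k).2), ?_⟩
  funext t
  simp only [signClass, Equiv.apply_symm_apply, Pi.neg_apply]
  cases (e k).1 <;> simp

theorem isSymmetricClass_signClass [Nonempty ι] (ω : ℕ → Bool × (ι → Bool)) :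
    IsSymmetricClass (Set.range (signClass e ω)) := by
  constructor
  · refine ⟨e.symm (0, Classical.arbitrary ι), ?_⟩
    funext t
    simp [signClass]
  · rintro _ ⟨k, rfl⟩
    exact neg_signClass_mem e ω k

theorem isBoundedClass_signClass (ω : ℕ → Bool × (ι → Bool)) :
    IsBoundedClass 1 (Set.range (signClass e ω)) := by
  rintro _ ⟨k, rfl⟩ t
  exact abs_signClass_le e ω k t

theorem measurable_signClass [Finite ι] : Measurable (signClass e) := by
  refine measurable_pi_iff.mpr fun k => measurable_pi_iff.mpr fun t => ?_
  exact (Measurable.of_discrete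
    (f := fun u : Bool × (ι → Bool) => ((e k).1 : ℝ) * spin (u.2 (e k).2))).comp
    (measurable_pi_apply t)

theorem measurable_label [Finite ι] (δ : ℝ) :
    Measurable fun (ω : ℕ → Bool × (ι → Bool)) t => label δ (ω t).1 := by
  refine measurable_pi_iff.mpr fun t => ?_
  exact (Measurable.of_discrete (f := fun u : Bool × (ι → Bool) => label δ u.1)).comp
    (measurable_pi_apply t)

/-- The average of the signs of a round. -/
noncomputable def signMean [Fintype ι] (u : Bool × (ι → Bool)) : ℝ :=
  (∑ j, spin (u.2 j)) / Fintype.card ι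

theorem signMean_mem_convexHull [Fintype ι] [Nonempty ι] (ω : ℕ → Bool × (ι → Bool)) :
    (fun t => signMean (ω t)) ∈ convexHull ℝ (Set.range (signClass e ω)) := by
  have hc : (Fintype.card ι : ℝ) ≠ 0 := by exact_mod_cast Fintype.card_ne_zero
  have h := (convex_convexHull ℝ (Set.range (signClass e ω))).sum_mem (t := Finset.univ)
    (w := fun _ : ι => (Fintype.card ι : ℝ)⁻¹) (z := fun j => signClass e ω (e.symm (1, j)))
    (fun _ _ => by positivity) (sum_inv_card (κ := ι))
    (fun j _ => subset_convexHull ℝ _ ⟨_, rfl⟩)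
  convert h using 1
  funext t
  simp only [signMean, signClass, Finset.sum_apply, Pi.smul_apply, Equiv.apply_symm_apply,
    SignType.coe_one, one_mul, smul_eq_mul]
  rw [← Finset.mul_sum, div_eq_inv_mul]

/-- The average of the class predicts the label of a round with small expected loss. -/
theorem lintegral_sqLoss_signMean_le [Fintype ι] [DecidableEq ι] [Nonempty ι] {δ : ℝ}
    (h0 : 0 ≤ δ) (h1 : δ ≤ 1) (t : ℕ) :
    ∫⁻ ω, ENNReal.ofReal (sqLoss (label δ (ω t).1) (signMean (ω t))) ∂settingLaw ι h0 h1
      ≤ ENNReal.ofReal (2 / Fintype.card ι) := by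
  have hmp := measurePreserving_eval_infinitePi
    (fun _ : ℕ => (roundLaw ι h0 h1).toMeasure) t
  have h := hmp.lintegral_comp
    (f := fun u => ENNReal.ofReal (sqLoss (label δ u.1) (signMean u))) Measurable.of_discrete
  rw [settingLaw]
  refine (h.trans (lintegral_roundLaw h0 h1 fun u => ?_)).le.trans ?_
  · rw [sqLoss]
    positivity
  · refine ENNReal.ofReal_le_ofReal ?_
    have e1 := sum_spinWeight_mul_sq_le (ι := ι) (q := δ) (abs_le.mpr ⟨by linarith, h1⟩)
    have e2 := sum_spinWeight_mul_sq_le (ι := ι) (q := 0) (by simp)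
    have e3 : (2 : ℝ) / Fintype.card ι = 4 / Fintype.card ι / 2 := by ring
    simp only [label, sqLoss, signMean, if_true, ← mul_div_assoc, ← Finset.sum_div]
    rw [e3]
    simp only [Bool.false_eq_true, if_false]
    linarith

end Setting

/-! ### Every booster makes many mistakes -/

theorem hedgeIndex_congr {X : Type*} {m : ℕ} [NeZero m] {f f' : Fin m → X → ℝ}
    {mem : List (X × (ℝ → ℝ))} (h : ∀ r ∈ mem, ∀ j, f j r.1 = f' j r.1) :
    hedgeIndex f mem = hedgeIndex f' mem := by
  have hw : hedgeWeight f mem = hedgeWeight f' mem := by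
    funext j
    have : (mem.map fun r => r.2 (f j r.1)) = mem.map fun r => r.2 (f' j r.1) :=
      List.map_congr_left fun r hr => by rw [h r hr j]
    rw [hedgeWeight, hedgeWeight, this]
  simp only [hedgeIndex, hw]

section Mistakes

variable {ι : Type*} {m : ℕ} [NeZero m] (e : Fin m ≃ SignType × ι)

theorem hedge_signClass_congr {ω ω' : ℕ → Bool × (ι → Bool)} {t : ℕ} (h : ∀ s ≤ t, ω s = ω' s)
    {mem : List (ℕ × (ℝ → ℝ))} (hmem : ∀ r ∈ mem, ∃ s < t, r.1 = s) :
    hedge (signClass e ω) mem t = hedge (signClass e ω') mem t := by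
  have h1 : hedgeIndex (signClass e ω) mem = hedgeIndex (signClass e ω') mem :=
    hedgeIndex_congr fun r hr j => by
      obtain ⟨s, hs, hrs⟩ := hmem r hr
      exact signClass_congr e (hrs ▸ h s hs.le) j
  rw [hedge, hedge, h1]
  congr 1
  funext j
  exact signClass_congr e (h t le_rfl) j

/-- The law of the state of the booster `B` after `T` rounds in the setting `ω`. -/
noncomputable def settingRun (N : ℕ) (B : Booster ℕ) (δ : ℝ) (ω : ℕ → Bool × (ι → Bool))
    (T : ℕ) : PMF (RunState ℕ) :=
  boostRun (hedge (signClass e ω)) N B (fun t => t) (fun t => sqLoss (label δ (ω t).1)) T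

theorem settingRun_congr (N : ℕ) (B : Booster ℕ) (δ : ℝ) {ω ω' : ℕ → Bool × (ι → Bool)} {T : ℕ}
    (h : ∀ t < T, ω t = ω' t) : settingRun e N B δ ω T = settingRun e N B δ ω' T := by
  refine boostRun_congr N B _ T (fun t ht => by rw [h t ht]) fun t ht mem hmem => ?_
  exact hedge_signClass_congr e (fun s hs => h s (hs.trans_lt ht)) hmem

/-- The probability of a mistake in round `T`, in the setting `ω`. A mistake is a loss of at least
`δ ^ 2 / 8`; a prediction that is not closer to the right label than to the wrong one is one. -/
noncomputable def roundMistakeProb (N : ℕ) (B : Booster ℕ) (δ : ℝ) (T : ℕ)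
    (ω : ℕ → Bool × (ι → Bool)) : ENNReal :=
  expectation (settingRun e N B δ ω T)
    (mistakeProb (hedge (signClass e ω)) N B T (sqLoss (label δ (ω T).1)) (δ ^ 2 / 8))

theorem roundMistakeProb_congr (N : ℕ) (B : Booster ℕ) (δ : ℝ) {T : ℕ}
    {ω ω' : ℕ → Bool × (ι → Bool)} (h : ∀ t < T + 1, ω t = ω' t) :
    roundMistakeProb e N B δ T ω = roundMistakeProb e N B δ T ω' := by
  rw [roundMistakeProb, roundMistakeProb,
    ← settingRun_congr e N B δ fun t ht => h t (ht.trans T.lt_succ_self), h T T.lt_succ_self]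
  refine expectation_congr fun st hst => ?_
  rw [mistakeProb, mistakeProb, answersLaw_congr fun i => hedge_signClass_congr e
    (fun s hs => h s (Nat.lt_succ_of_le hs)) (exists_lt_of_mem_memory _ _ _ _ _ T st hst i)]

/-- With the past fixed, a booster errs in round `T` with probability at least `9 / 20` over the
draw of this round. -/
theorem le_lintegral_mistakeProb [Fintype ι] [DecidableEq ι] {N : ℕ} (hN : 1 ≤ N) (B : Booster ℕ)
    {δ : ℝ} (h0 : 0 ≤ δ) (h1 : δ ≤ 1) (hδ : δ ^ 2 = 1 / (100 * N)) (T : ℕ)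
    (ω : ℕ → Bool × (ι → Bool)) (st : RunState ℕ)
    (hst : ∀ i, ∀ r ∈ st.memory i, ∃ s < T, r.1 = s) :
    ENNReal.ofReal (9 / 20) ≤ ∫⁻ u, mistakeProb (hedge (signClass e (Function.update ω T u))) N B T
      (sqLoss (label δ u.1)) (δ ^ 2 / 8) st ∂(roundLaw ι h0 h1).toMeasure := by
  set A : (ι → Bool) → OnlineLearner ℕ := fun v => hedge (signClass e (Function.update ω T
    (true, v))) with hA
  set P : (ι → Bool) → PMF (List ℝ) := fun v =>
    answersLaw (A v) st.memory T (B.call st.rounds T) N [] with hP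
  set G : Set (List ℝ) := {a | B.predict st.rounds T a ≤ δ / 2} with hG
  -- the class does not depend on the bit that selects the label
  have hclass : ∀ (b : Bool) (v : ι → Bool), signClass e (Function.update ω T (b, v))
      = signClass e (Function.update ω T (true, v)) := by
    intro b v
    funext k t
    by_cases ht : t = T
    · subst ht
      simp [signClass]
    · simp [signClass, ht]
  have hlearn : ∀ i v, A v (st.memory i) T = (hedgeIndex (signClass e ω) (st.memory i)).map
      fun k => ((e k).1 : ℝ) * spin (v (e k).2) := by
    intro i v
    have hidx : hedgeIndex (signClass e (Function.update ω T (true, v))) (st.memory i)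
        = hedgeIndex (signClass e ω) (st.memory i) :=
      hedgeIndex_congr fun r hr j => by
        obtain ⟨s, hs, hrs⟩ := hst i r hr
        refine signClass_congr e ?_ j
        rw [hrs, Function.update_of_ne hs.ne]
    simp only [hA, hedge, hidx]
    congr 1
    funext k
    simp [signClass]
  have key := (nine_tenths_le_errorPotential hN hδ).trans
    (errorPotential_le h0 h1 hlearn (B.call st.rounds T) G N [] (fun _ => δ) (fun _ => 0) 1 1
      zero_le_one zero_le_one fun _ => Or.inl ⟨rfl, rfl⟩)
  set E : Bool → Set (List ℝ) := fun b => if b then G else Gᶜ with hE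
  have hsub : ∀ b, E b ⊆ {a | δ ^ 2 / 8 ≤ sqLoss (label δ b) (B.predict st.rounds T a)} := by
    intro b a ha
    rw [Set.mem_ofPred_eq, sqLoss]
    generalize hz : B.predict st.rounds T a = z
    cases b
    · have hz' : δ / 2 < z := by
        rw [← hz]
        exact not_le.mp ha
      rw [show label δ false = 0 from rfl]
      nlinarith
    · have hz' : z ≤ δ / 2 := by
        rw [← hz]
        exact ha
      rw [show label δ true = δ from rfl]
      nlinarith
  have hmist : ∀ u : Bool × (ι → Bool), (P u.2).toOuterMeasure (E u.1)
      ≤ mistakeProb (hedge (signClass e (Function.update ω T u))) N B T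
        (sqLoss (label δ u.1)) (δ ^ 2 / 8) st := by
    rintro ⟨b, v⟩
    rw [mistakeProb, hclass b v]
    exact measure_mono (hsub b)
  have hint := lintegral_roundLaw h0 h1
    (g := fun u : Bool × (ι → Bool) => ((P u.2).toOuterMeasure (E u.1)).toReal)
    fun u => ENNReal.toReal_nonneg
  refine le_trans ?_ (lintegral_mono fun u => ENNReal.ofReal_toReal_le.trans (hmist u))
  rw [hint]
  refine ENNReal.ofReal_le_ofReal ?_
  rw [one_mul, one_mul] at key
  rw [le_div_iff₀ two_pos, show (9 / 20 : ℝ) * 2 = 9 / 10 by norm_num]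
  exact key

theorem lintegral_expectation_fintype {α Y : Type*} [MeasurableSpace Y] [Fintype Y]
    [MeasurableSingletonClass Y] (μ : Measure Y) (p : PMF α) (g : Y → α → ENNReal) :
    ∫⁻ u, expectation p (g u) ∂μ = expectation p fun a => ∫⁻ u, g u a ∂μ := by
  simp only [lintegral_fintype, expectation, Finset.mul_sum, ← ENNReal.tsum_mul_right, mul_assoc]
  simp only [← tsum_fintype (L := .unconditional Y)]
  exact ENNReal.tsum_comm

theorem le_lintegral_roundMistakeProb [Fintype ι] [DecidableEq ι] {N : ℕ} (hN : 1 ≤ N)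
    (B : Booster ℕ) {δ : ℝ} (h0 : 0 ≤ δ) (h1 : δ ≤ 1) (hδ : δ ^ 2 = 1 / (100 * N)) (T : ℕ) :
    ENNReal.ofReal (9 / 20) ≤ ∫⁻ ω, roundMistakeProb e N B δ T ω ∂settingLaw ι h0 h1 := by
  have hmeas : Measurable (roundMistakeProb e N B δ T) :=
    measurable_of_forall_lt (T + 1) fun ω ω' h => roundMistakeProb_congr e N B δ h
  rw [settingLaw, lintegral_infinitePi_resample _ T hmeas]
  refine le_trans ?_ (lintegral_mono (f := fun _ => ENNReal.ofReal (9 / 20)) fun ω => ?_)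
  · rw [lintegral_const, measure_univ, mul_one]
  · have hrun : ∀ u, settingRun e N B δ (Function.update ω T u) T = settingRun e N B δ ω T :=
      fun u => settingRun_congr e N B δ fun t ht => Function.update_of_ne ht.ne _ _
    simp only [roundMistakeProb, hrun, Function.update_self]
    rw [lintegral_expectation_fintype]
    refine (expectation_const (settingRun e N B δ ω T) (ENNReal.ofReal (9 / 20))).symm.le.trans
      (expectation_mono fun st hst => ?_)
    exact le_lintegral_mistakeProb e hN B h0 h1 hδ T ω st
      (exists_lt_of_mem_memory _ _ _ _ _ T st hst)

theorem le_lintegral_mistakes [Fintype ι] [DecidableEq ι] {N : ℕ} (hN : 1 ≤ N)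
    (B : Booster ℕ) {δ : ℝ} (h0 : 0 ≤ δ) (h1 : δ ≤ 1) (hδ : δ ^ 2 = 1 / (100 * N)) (T : ℕ) :
    ENNReal.ofReal (9 / 20 * T) ≤ ∫⁻ ω, expectation (settingRun e N B δ ω T)
      (fun st => ENNReal.ofReal (mistakes (δ ^ 2 / 8) st.rounds)) ∂settingLaw ι h0 h1 := by
  induction T with
  | zero => simp
  | succ T ih =>
    have hstep : ∀ ω : ℕ → Bool × (ι → Bool), expectation (settingRun e N B δ ω (T + 1))
        (fun st => ENNReal.ofReal (mistakes (δ ^ 2 / 8) st.rounds))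
        = expectation (settingRun e N B δ ω T)
          (fun st => ENNReal.ofReal (mistakes (δ ^ 2 / 8) st.rounds))
          + roundMistakeProb e N B δ T ω := fun ω => expectation_mistakes_succ _ _ _ _ _ _ _
    simp only [hstep]
    refine le_trans ?_ (le_lintegral_add _ _)
    refine le_trans (le_of_eq ?_)
      (add_le_add ih (le_lintegral_roundMistakeProb e hN B h0 h1 hδ T))
    rw [← ENNReal.ofReal_add (by positivity) (by norm_num)]
    congr 1
    push_cast
    ring

/-- In every setting the mistakes are paid for by a large regret or by the loss of the average. -/
theorem expectation_mistakes_le [Fintype ι] [Nonempty ι] {N : ℕ} (hN : 1 ≤ N) (B : Booster ℕ)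
    {δ : ℝ} (hδ : δ ^ 2 = 1 / (100 * N)) (T : ℕ) (ω : ℕ → Bool × (ι → Bool)) :
    expectation (settingRun e N B δ ω T)
        (fun st => ENNReal.ofReal (mistakes (δ ^ 2 / 8) st.rounds))
      ≤ ENNReal.ofReal T * probRegretGE (hedge (signClass e ω)) N B (Set.range (signClass e ω))
          (fun t => t) (fun t => sqLoss (label δ (ω t).1)) T (1 / 8000 * T / N)
        + ENNReal.ofReal (T / 10 + 800 * N *
          ∑ t ∈ Finset.range T, sqLoss (label δ (ω t).1) (signMean (ω t))) := by
  have hN' : (0 : ℝ) < N := by exact_mod_cast hN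
  have hnn : ∀ t z, 0 ≤ sqLoss (label δ (ω t).1) z := fun t z => by
    rw [sqLoss]
    positivity
  set Z := ENNReal.ofReal (T / 10 + 800 * N *
    ∑ t ∈ Finset.range T, sqLoss (label δ (ω t).1) (signMean (ω t))) with hZ
  rw [probRegretGE, toOuterMeasure_eq_expectation, ← expectation_const_mul, ← settingRun,
    ← expectation_const (settingRun e N B δ ω T) Z, ← expectation_add]
  refine expectation_mono fun st hst => ?_
  by_cases hreg : 1 / 8000 * T / N ≤ regret (convexHull ℝ (Set.range (signClass e ω)))
      (st.rounds.map Round.toPlay)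
  · have hlen : (st.rounds.length : ℝ) = T := by
      have h := sum_rounds_eq _ _ _ _ _ (fun _ _ => 1) T st hst
      simpa using h
    rw [Set.indicator_of_mem (by exact hreg), Pi.one_apply, mul_one]
    refine le_add_right (ENNReal.ofReal_le_ofReal ?_)
    exact (mistakes_le_length _ _).trans_eq hlen
  · rw [Set.indicator_of_notMem (by exact hreg), mul_zero, zero_add]
    refine ENNReal.ofReal_le_ofReal ?_
    have h := mistakes_le_of_regret_lt hnn hst (signMean_mem_convexHull e ω)
      (θ := δ ^ 2 / 8) (not_le.mp hreg)
    rw [hδ] at h ⊢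
    have h2 := mul_le_mul_of_nonneg_left h (show (0 : ℝ) ≤ 800 * N by positivity)
    calc _ = 800 * N * (1 / (100 * N) / 8 * mistakes (1 / (100 * N) / 8) st.rounds) := by
          field_simp
          ring
      _ ≤ _ := h2
      _ = _ := by
          field_simp
          ring

theorem one_tenth_le_lintegral_probRegretGE [Fintype ι] [DecidableEq ι] [Nonempty ι] {N : ℕ}
    (hN : 1 ≤ N) (hι : Fintype.card ι = 32000 * N) (B : Booster ℕ) {δ : ℝ} (h0 : 0 ≤ δ)
    (h1 : δ ≤ 1) (hδ : δ ^ 2 = 1 / (100 * N)) (T : ℕ) :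
    1 / 10 ≤ ∫⁻ ω, probRegretGE (hedge (signClass e ω)) N B (Set.range (signClass e ω))
      (fun t => t) (fun t => sqLoss (label δ (ω t).1)) T (1 / 8000 * T / N)
      ∂settingLaw ι h0 h1 := by
  have hN' : (0 : ℝ) < N := by exact_mod_cast hN
  rcases Nat.eq_zero_or_pos T with rfl | hT
  · have hone : ∀ ω : ℕ → Bool × (ι → Bool), probRegretGE (hedge (signClass e ω)) N B
        (Set.range (signClass e ω)) (fun t => t) (fun t => sqLoss (label δ (ω t).1)) 0
        (1 / 8000 * (0 : ℕ) / N) = 1 := by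
      intro ω
      have : Nonempty (convexHull ℝ (Set.range (signClass e ω))) :=
        ⟨_, signMean_mem_convexHull e ω⟩
      rw [probRegretGE, boostRun, PMF.toOuterMeasure_pure_apply, if_pos]
      simp [regret]
    simp only [hone, lintegral_const, measure_univ, mul_one]
    exact ENNReal.div_le_of_le_mul (by norm_num)
  have hT' : (0 : ℝ) < T := by exact_mod_cast hT
  set I := ∫⁻ ω, probRegretGE (hedge (signClass e ω)) N B (Set.range (signClass e ω))
      (fun t => t) (fun t => sqLoss (label δ (ω t).1)) T (1 / 8000 * T / N)
      ∂settingLaw ι h0 h1 with hI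
  have hmeasY : ∀ t, Measurable fun ω : ℕ → Bool × (ι → Bool) =>
      ENNReal.ofReal (sqLoss (label δ (ω t).1) (signMean (ω t))) := fun t =>
    (Measurable.of_discrete (f := fun u : Bool × (ι → Bool) =>
      ENNReal.ofReal (sqLoss (label δ u.1) (signMean u)))).comp (measurable_pi_apply t)
  have hsplit : ∀ ω : ℕ → Bool × (ι → Bool), ENNReal.ofReal (T / 10 + 800 * N *
      ∑ t ∈ Finset.range T, sqLoss (label δ (ω t).1) (signMean (ω t)))
      = ENNReal.ofReal (T / 10) + ENNReal.ofReal (800 * N) *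
        ∑ t ∈ Finset.range T, ENNReal.ofReal (sqLoss (label δ (ω t).1) (signMean (ω t))) := by
    intro ω
    have hnn : ∀ t ∈ Finset.range T, 0 ≤ sqLoss (label δ (ω t).1) (signMean (ω t)) :=
      fun t _ => by
        rw [sqLoss]
        positivity
    rw [ENNReal.ofReal_add (by positivity) (mul_nonneg (by positivity) (Finset.sum_nonneg hnn)),
      ENNReal.ofReal_mul (by positivity), ENNReal.ofReal_sum_of_nonneg hnn]
  have hmain : ENNReal.ofReal (9 / 20 * T)
      ≤ ENNReal.ofReal T * I + (ENNReal.ofReal (T / 10) + ENNReal.ofReal (T / 20)) := by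
    refine (le_lintegral_mistakes e hN B h0 h1 hδ T).trans
      ((lintegral_mono fun ω => expectation_mistakes_le e hN B hδ T ω).trans ?_)
    simp only [hsplit]
    have hmeasS := Finset.measurable_fun_sum (Finset.range T) fun t _ => hmeasY t
    rw [lintegral_add_right _ ((hmeasS.const_mul _).const_add _),
      lintegral_const_mul' _ _ ENNReal.ofReal_ne_top, lintegral_add_left measurable_const,
      lintegral_const, measure_univ, mul_one, lintegral_const_mul' _ _ ENNReal.ofReal_ne_top,
      lintegral_finsetSum _ fun t _ => hmeasY t, ← hI]
    gcongr
    calc ENNReal.ofReal (800 * N) * ∑ t ∈ Finset.range T, ∫⁻ ω, ENNReal.ofReal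
          (sqLoss (label δ (ω t).1) (signMean (ω t))) ∂settingLaw ι h0 h1
        ≤ ENNReal.ofReal (800 * N) * ∑ _t ∈ Finset.range T,
            ENNReal.ofReal (2 / Fintype.card ι) := by
          gcongr with t
          exact lintegral_sqLoss_signMean_le h0 h1 t
      _ = ENNReal.ofReal (T / 20) := by
          rw [← ENNReal.ofReal_sum_of_nonneg fun _ _ => by positivity,
            ← ENNReal.ofReal_mul (by positivity), Finset.sum_const, Finset.card_range, hι,
            nsmul_eq_mul]
          congr 1
          push_cast
          field_simp
          norm_num
  by_contra hlt
  have hI10 : I ≤ ENNReal.ofReal (1 / 10) := by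
    rw [ENNReal.ofReal_div_of_pos (by norm_num)]
    simpa using (not_le.mp hlt).le
  have := hmain.trans (add_le_add_left (mul_le_mul_right hI10 (ENNReal.ofReal T)) _)
  rw [← ENNReal.ofReal_mul hT'.le, ← ENNReal.ofReal_add (by positivity) (by positivity),
    ← ENNReal.ofReal_add (by positivity) (by positivity),
    ENNReal.ofReal_le_ofReal_iff (by positivity)] at this
  linarith

end Mistakes

/-! ### The squared losses and the conclusion -/

theorem isConvexSmooth_squaredLosses : IsConvexSmooth 1 squaredLosses := by
  rintro _ ⟨a, _, rfl⟩
  have hd : ∀ z, HasDerivAt (sqLoss a) (z - a) z := by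
    intro z
    have h : HasDerivAt (fun z => (z - a) ^ 2 / 2) _ z :=
      (((hasDerivAt_id' z).sub_const a).pow 2).div_const 2
    exact h.congr_deriv (by norm_num)
  refine ⟨?_, fun z => (hd z).differentiableAt, fun z z' => ?_⟩
  · refine ⟨convex_univ, fun z _ z' _ s t hs ht hst => ?_⟩
    obtain rfl : t = 1 - s := by linarith
    simp only [sqLoss, smul_eq_mul]
    nlinarith [mul_nonneg (mul_nonneg hs ht) (sq_nonneg (z - z'))]
  · rw [(hd z).deriv, sq_abs]
    simp only [sqLoss]
    linarith [sq_nonneg (z - z')]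

end OnlineBoosting

theorem theorem3 :
    ∃ c : ℝ, 0 < c ∧ ∃ K : ℝ, 0 < K ∧ ∀ N : ℕ, 1 ≤ N →
      -- a random class of `m` functions on `ℕ` and a random label sequence
      ∃ (m : ℕ) (_ : NeZero m) (Ω : Type) (_ : MeasurableSpace Ω) (ν : Measure Ω)
        (_ : IsProbabilityMeasure ν) (f : Ω → Fin m → ℕ → ℝ) (y : Ω → ℕ → ℝ),
        Measurable f ∧ Measurable y ∧
        (∀ ω, OnlineBoosting.IsBoundedClass 1 (Set.range (f ω))) ∧
        (∀ ω, OnlineBoosting.IsSymmetricClass (Set.range (f ω))) ∧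
        -- Hedge is an online linear learner for the class
        (∀ ω, OnlineBoosting.IsOnlineLearner (OnlineBoosting.hedge (f ω)) (Set.range (f ω))
          OnlineBoosting.linearLosses
          (fun T δ => K * (Real.sqrt (T * Real.log m) + Real.sqrt (T * Real.log (1 / δ))))) ∧
        OnlineBoosting.IsConvexSmooth 1 OnlineBoosting.squaredLosses ∧
        (∀ ω t, OnlineBoosting.sqLoss (y ω t) ∈ OnlineBoosting.squaredLosses) ∧
        -- every booster, with random seed `s` drawn from `P`, has regret at least `c * T / N`
        ∀ (S : Type*) [MeasurableSpace S] (P : Measure S) [IsProbabilityMeasure P]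
          (B : S → OnlineBoosting.Booster ℕ) (T : ℕ),
          1 / 10 ≤ ∫⁻ s, ∫⁻ ω, OnlineBoosting.probRegretGE (OnlineBoosting.hedge (f ω)) N (B s)
            (Set.range (f ω)) (fun t => t) (fun t => OnlineBoosting.sqLoss (y ω t)) T
            (c * T / N) ∂ν ∂P := by
  refine ⟨1 / 8000, by norm_num, 4, by norm_num, fun N hN => ?_⟩
  have hN' : (1 : ℝ) ≤ N := by exact_mod_cast hN
  have : Nonempty (Fin (32000 * N)) := ⟨⟨0, by omega⟩⟩
  let e : Fin (Fintype.card (SignType × Fin (32000 * N))) ≃ SignType × Fin (32000 * N) :=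
    (Fintype.equivFin _).symm
  have hm : 1 < Fintype.card (SignType × Fin (32000 * N)) := by
    rw [Fintype.card_prod, Fintype.card_fin, show Fintype.card SignType = 3 from rfl]
    omega
  have hne : NeZero (Fintype.card (SignType × Fin (32000 * N))) := ⟨by omega⟩
  -- the two labels differ by `δ = 1 / (10 * √N)`
  set δ : ℝ := Real.sqrt (1 / (100 * N)) with hδdef
  have hδ : δ ^ 2 = 1 / (100 * N) := Real.sq_sqrt (by positivity)
  have h0 : 0 ≤ δ := Real.sqrt_nonneg _
  have h1 : δ ≤ 1 := by
    refine Real.sqrt_le_iff.mpr ⟨zero_le_one, ?_⟩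
    rw [one_pow, div_le_one (by positivity)]
    linarith
  refine ⟨_, hne, ℕ → Bool × (Fin (32000 * N) → Bool), inferInstance,
    OnlineBoosting.settingLaw _ h0 h1, inferInstance, OnlineBoosting.signClass e,
    fun ω t => OnlineBoosting.label δ (ω t).1, OnlineBoosting.measurable_signClass e,
    OnlineBoosting.measurable_label δ, OnlineBoosting.isBoundedClass_signClass e,
    OnlineBoosting.isSymmetricClass_signClass e,
    fun ω => OnlineBoosting.isOnlineLearner_hedge hm (OnlineBoosting.abs_signClass_le e ω),
    OnlineBoosting.isConvexSmooth_squaredLosses,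
    fun ω t => ⟨_, OnlineBoosting.label_mem h0 h1 _, rfl⟩, fun S _ P _ B T => ?_⟩
  calc (1 / 10 : ENNReal) = ∫⁻ _ : S, 1 / 10 ∂P := by rw [lintegral_const, measure_univ, mul_one]
    _ ≤ _ := lintegral_mono fun s => OnlineBoosting.one_tenth_le_lintegral_probRegretGE e hN
      (Fintype.card_fin _) (B s) h0 h1 hδ T
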